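/- A digraph $G$ consists of a finite vertex set $V(G)$ and a set $A(G)$ of arcs, each arc being an ordered pair of distinct vertices of $G$ (so there are no loops and no parallel arcs, but $(u,v)$ and $(v,u)$ may both be arcs). A subdigraph of $G$ is a digraph $H$ with $V(H)\subseteq V(G)$ and $A(H)\subseteq A(G)$; it is proper if $H\neq G$. The dichromatic number $\vec{\chi}(G)$ is the least integer $n \ge 0$ such that $V(G)$ can be coloured with $n$ colours so that each colour class induces a subdigraph without directed cycle (two opposite arcs $(u,v),(v,u)$ form a directed cycle). The digraph $G$ is $k$-dicritical if $\vec{\chi}(G)=k$ and $\vec{\chi}(H)<k$ for every proper subdigraph $H$ of $G$. **Theorem.** Let $k\ge 5$ be an integer and let $G$ be a $k$-dicritical digraph. Then $$|A(G)| \;\ge\; \Big(k-\frac12-\frac1{k-1}\Big)\,|V(G)| \;-\; k\Big(\frac12-\frac1{k-1}\Big).$$ -/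

import Mathlib

/-- A finite simple digraph whose vertices are elements of `V`: a finite vertex set together with a
set of arcs, each arc being an ordered pair of two distinct vertices. Opposite arcs `(u, v)` and
`(v, u)` may both be present; loops and parallel arcs may not. -/
@[ext]
structure FinDigraph (V : Type*) where
  verts : Finset V
  arcs : Finset (V × V)
  fst_mem : ∀ a ∈ arcs, a.1 ∈ verts
  snd_mem : ∀ a ∈ arcs, a.2 ∈ verts
  fst_ne_snd : ∀ a ∈ arcs, a.1 ≠ a.2

namespace FinDigraph

/-- `H` is a subdigraph of `G`. -/
def IsSubdigraph {V : Type*} (H G : FinDigraph V) : Prop :=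
  H.verts ⊆ G.verts ∧ H.arcs ⊆ G.arcs

open Classical in
/-- The subdigraph `G[X]` of `G` induced by the vertices of `G` that lie in `X`. -/
noncomputable def induce {V : Type*} (G : FinDigraph V) (X : Set V) : FinDigraph V where
  verts := G.verts.filter (fun v => v ∈ X)
  arcs := G.arcs.filter (fun a => a.1 ∈ X ∧ a.2 ∈ X)
  fst_mem a ha := by
    rw [Finset.mem_filter] at ha ⊢
    exact ⟨G.fst_mem a ha.1, ha.2.1⟩
  snd_mem a ha := by
    rw [Finset.mem_filter] at ha ⊢
    exact ⟨G.snd_mem a ha.1, ha.2.2⟩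
  fst_ne_snd a ha := G.fst_ne_snd a (Finset.mem_filter.1 ha).1

theorem mem_arcs_induce {V : Type*} {G : FinDigraph V} {X : Set V} {a : V × V} :
    a ∈ (G.induce X).arcs ↔ a ∈ G.arcs ∧ a.1 ∈ X ∧ a.2 ∈ X := by
  classical
  exact Finset.mem_filter

/-- `G` has no directed cycle: there is no directed walk of positive length from a vertex to itself.
(A pair of opposite arcs is a directed cycle of length two.) -/
def IsAcyclic {V : Type*} (G : FinDigraph V) : Prop :=
  ∀ v : V, ¬ Relation.TransGen (fun x y => (x, y) ∈ G.arcs) v v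

/-- `φ` is a dicolouring of `G` with the `n` colours `0, …, n - 1`: each colour class induces an
acyclic subdigraph. Values of `φ` outside the vertex set of `G` are irrelevant. -/
def IsDicolouring {V : Type*} (G : FinDigraph V) (n : ℕ) (φ : V → ℕ) : Prop :=
  (∀ v ∈ G.verts, φ v < n) ∧ ∀ i : ℕ, (G.induce {v | φ v = i}).IsAcyclic

/-- `G` has a dicolouring with `n` colours. -/
def IsDicolourable {V : Type*} (G : FinDigraph V) (n : ℕ) : Prop :=
  ∃ φ : V → ℕ, G.IsDicolouring n φ

/-- The dichromatic number of `G`. -/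
noncomputable def dichromaticNumber {V : Type*} (G : FinDigraph V) : ℕ :=
  sInf {n : ℕ | G.IsDicolourable n}

/-- The set whose infimum is the dichromatic number is never empty, so that the dichromatic number
is a genuine minimum. -/
theorem exists_isDicolourable {V : Type*} (G : FinDigraph V) : ∃ n : ℕ, G.IsDicolourable n := by
  classical
  let e := G.verts.equivFin
  refine ⟨G.verts.card, fun v => if h : v ∈ G.verts then (e ⟨v, h⟩ : ℕ) else 0, ?_, ?_⟩
  · intro v hv
    simp only [hv, dif_pos]
    exact (e ⟨v, hv⟩).isLt
  · intro i v hv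
    obtain ⟨w, hw, -⟩ := Relation.TransGen.head'_iff.1 hv
    obtain ⟨ha, h1, h2⟩ := mem_arcs_induce.1 hw
    have hv' := G.fst_mem _ ha
    have hw' := G.snd_mem _ ha
    have hne := G.fst_ne_snd _ ha
    simp only [Set.mem_ofPred_eq] at h1 h2 hv' hw' hne
    rw [dif_pos hv'] at h1
    rw [dif_pos hw'] at h2
    have := e.injective (Fin.ext (h1.trans h2.symm))
    exact hne (congrArg Subtype.val this)

/-- `G` is dicritical: every proper subdigraph has smaller dichromatic number. -/
def IsDicritical {V : Type*} (G : FinDigraph V) : Prop :=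
  ∀ H : FinDigraph V, H.IsSubdigraph G → H ≠ G → H.dichromaticNumber < G.dichromaticNumber

/-- `G` is `k`-dicritical: it is dicritical with dichromatic number `k`. -/
def IsKDicritical {V : Type*} (G : FinDigraph V) (k : ℕ) : Prop :=
  G.IsDicritical ∧ G.dichromaticNumber = k

end FinDigraph

/-! Put n = k - 1 and give a digraph with s vertices and m arcs the potential (2n² + n - 2)s - 2nm.
The claim becomes that a critical digraph has potential at most n² - n - 2, the value for the
complete digraph on n + 1 vertices. Consider a counterexample with fewest vertices, then fewest
arcs, then most pairs of twins (vertices with the same closed out- and in-neighbourhoods).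

Every proper set of at least two vertices has potential above n(3n - 2), unless it is a clique of
order n, where equality holds (`lt_wt_ind`). To see this, colour a set R of least potential,
contract its colour classes and join them completely. The result contains a smaller critical digraph
W, and minimality forces W to use everything outside R and just one colour class. A few digons added
to R before colouring it rule this out. It follows that a proper part of the counterexample stays
n-colourable when up to n - 1 arcs are added (`col_ind_union`).

Call a vertex low if both its degrees are n. Replacing a neighbour of a low vertex x by a vertex
that imitates x yields either a clique of order n or a digraph that the choice of the counterexample
forbids (`of_replace`). This controls the neighbours of low vertices (`isClique_of_few`,
`isClique_of_twins`, `low_inClique`). If an arc without its opposite goes from a low vertex to a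
vertex y of out-degree n, then the out-neighbours of y all have very large degree (`isClique_outN`,
`two_mul_le_outN`).

The end is a discharging argument. A vertex of degree d starts with nd - (2n² + n - 2), which is -(n
- 2) at low vertices, 2 at degree 2n + 1, and larger above. Vertices of degree at least 2n + 2
spread their charge evenly over their arcs. A vertex of degree 2n + 1 with n rich neighbours on its
smaller side sends charge to low vertices on the other side. Low vertices in a clique of order n
forward charge to a low vertex outside all such cliques. No vertex ends negative, so the potential
is at most 0, a contradiction. -/

namespace ArcSet

set_option linter.unusedSectionVars false

open Finset

variable {V : Type*}

/-! ### Monochromatic cycles and their images under maps -/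

/-- The arcs of `E` whose two ends have the same colour. -/
def Mono (E : Finset (V × V)) {C : Type*} (φ : V → C) (x y : V) : Prop :=
  (x, y) ∈ E ∧ φ x = φ y

/-- No directed cycle of `E` is monochromatic. -/
def Proper (E : Finset (V × V)) {C : Type*} (φ : V → C) : Prop :=
  ∀ v, ¬ Relation.TransGen (Mono E φ) v v

/-- `E` has a dicolouring with `n` colours. -/
def Col (n : ℕ) (E : Finset (V × V)) : Prop :=
  ∃ φ : V → Fin n, Proper E φ

theorem Proper.mono {E F : Finset (V × V)} {C : Type*} {φ : V → C} (h : Proper E φ) (hF : F ⊆ E) :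
    Proper F φ := fun v hv =>
  h v (Relation.TransGen.mono (fun _ _ hab => ⟨hF hab.1, hab.2⟩) _ _ hv)

theorem Col.mono {n : ℕ} {E F : Finset (V × V)} (h : Col n E) (hF : F ⊆ E) : Col n F :=
  h.imp fun _ hφ => hφ.mono hF

theorem Proper.congr {E : Finset (V × V)} {C : Type*} {φ ψ : V → C} (h : Proper E φ)
    (hE : ∀ a ∈ E, ψ a.1 = φ a.1 ∧ ψ a.2 = φ a.2) : Proper E ψ := fun v hv =>
  h v (Relation.TransGen.mono (fun _ _ hab =>
    ⟨hab.1, by rw [← (hE _ hab.1).1, ← (hE _ hab.1).2]; exact hab.2⟩) _ _ hv)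

/-- A colouring pulled back along a map of digraphs. -/
theorem Proper.comap {V' : Type*} {E : Finset (V × V)} {F : Finset (V' × V')} {C : Type*}
    {ψ : V' → C} (h : Proper F ψ) (σ : V → V') (hσ : ∀ a ∈ E, (σ a.1, σ a.2) ∈ F) :
    Proper E (fun v => ψ (σ v)) := fun v hv =>
  h (σ v) (Relation.TransGen.lift σ (fun _ _ hab => ⟨hσ _ hab.1, hab.2⟩) _ _ hv)

/-- Steps inside a fibre of `σ` disappear in the image; a walk either keeps at least one step there
or never leaves its fibre. -/
theorem transGen_cycle_of_map {V' : Type*} {r : V → V → Prop} {r' : V' → V' → Prop} (σ : V → V')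
    (hσ : ∀ u v, r u v → σ u = σ v ∨ r' (σ u) (σ v)) {a b : V} (h : Relation.TransGen r a b) :
    Relation.TransGen r' (σ a) (σ b) ∨
      (σ a = σ b ∧ Relation.TransGen (fun u v => r u v ∧ σ u = σ v) a b) := by
  induction h with
  | single h =>
    by_cases he : σ a = σ ‹V›
    · exact Or.inr ⟨he, .single ⟨h, he⟩⟩
    · exact Or.inl (.single ((hσ _ _ h).resolve_left he))
  | tail _ h ih =>
    rename_i b c _
    by_cases he : σ b = σ c
    · rcases ih with ih | ⟨h1, h2⟩
      · exact Or.inl (he ▸ ih)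
      · exact Or.inr ⟨h1.trans he, h2.tail ⟨h, he⟩⟩
    · have h' := (hσ _ _ h).resolve_left he
      rcases ih with ih | ⟨h1, h2⟩
      · exact Or.inl (ih.tail h')
      · exact Or.inl (by rw [h1]; exact .single h')

/-- The image of a monochromatic cycle is a monochromatic closed walk of `F`, unless the cycle lies
in one fibre; the two hypotheses exclude both cases. -/
theorem Proper.contract {V' : Type*} {E : Finset (V × V)} {F : Finset (V' × V')} {C D : Type*}
    {φ : V → D} {ψ : V' → C} (h : Proper F ψ) (σ : V → V')
    (hσ : ∀ u v, Mono E φ u v → σ u = σ v ∨ Mono F ψ (σ u) (σ v))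
    (hE : ∀ v, ¬ Relation.TransGen (fun x y => Mono E φ x y ∧ σ x = σ y) v v) :
    Proper E φ := fun v hv =>
  (transGen_cycle_of_map σ hσ hv).elim (h _) fun h2 => hE v h2.2

variable [DecidableEq V]

/-! ### Deletion, induced parts and neighbourhoods -/

/-- The arcs of `E` that avoid `S`. -/
def del (E : Finset (V × V)) (S : Finset V) : Finset (V × V) :=
  E.filter fun a => a.1 ∉ S ∧ a.2 ∉ S

/-- The arcs of `E` with both ends in `R`. -/
def ind (E : Finset (V × V)) (R : Finset V) : Finset (V × V) :=
  E.filter fun a => a.1 ∈ R ∧ a.2 ∈ R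

/-- The vertices incident with an arc of `E`. -/
def supp (E : Finset (V × V)) : Finset V := E.image Prod.fst ∪ E.image Prod.snd

/-- The out-neighbours of `v`. -/
def outN (E : Finset (V × V)) (v : V) : Finset V := (E.filter fun a => a.1 = v).image Prod.snd

/-- The in-neighbours of `v`. -/
def inN (E : Finset (V × V)) (v : V) : Finset V := (E.filter fun a => a.2 = v).image Prod.fst

/-- The digraph with all arcs reversed. -/
def rev (E : Finset (V × V)) : Finset (V × V) := E.image Prod.swap

@[simp] theorem mem_del {E : Finset (V × V)} {S : Finset V} {a : V × V} :
    a ∈ del E S ↔ a ∈ E ∧ a.1 ∉ S ∧ a.2 ∉ S := by simp [del]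

@[simp] theorem mem_ind {E : Finset (V × V)} {S : Finset V} {a : V × V} :
    a ∈ ind E S ↔ a ∈ E ∧ a.1 ∈ S ∧ a.2 ∈ S := by simp [ind]

theorem mem_supp {E : Finset (V × V)} {v : V} :
    v ∈ supp E ↔ ∃ w, (v, w) ∈ E ∨ (w, v) ∈ E := by
  simp only [supp, mem_union, mem_image, Prod.exists]
  constructor
  · rintro (⟨a, b, h, rfl⟩ | ⟨a, b, h, rfl⟩)
    · exact ⟨b, Or.inl h⟩
    · exact ⟨a, Or.inr h⟩
  · rintro ⟨w, h | h⟩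
    · exact Or.inl ⟨_, _, h, rfl⟩
    · exact Or.inr ⟨_, _, h, rfl⟩

theorem fst_mem_supp {E : Finset (V × V)} {a : V × V} (h : a ∈ E) : a.1 ∈ supp E :=
  mem_supp.2 ⟨a.2, Or.inl h⟩

theorem snd_mem_supp {E : Finset (V × V)} {a : V × V} (h : a ∈ E) : a.2 ∈ supp E :=
  mem_supp.2 ⟨a.1, Or.inr h⟩

@[simp] theorem mem_outN {E : Finset (V × V)} {v w : V} : w ∈ outN E v ↔ (v, w) ∈ E := by
  simp only [outN, mem_image, mem_filter, Prod.exists]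
  constructor
  · rintro ⟨a, b, ⟨h, rfl⟩, rfl⟩; exact h
  · intro h; exact ⟨_, _, ⟨h, rfl⟩, rfl⟩

@[simp] theorem mem_inN {E : Finset (V × V)} {v w : V} : w ∈ inN E v ↔ (w, v) ∈ E := by
  simp only [inN, mem_image, mem_filter, Prod.exists]
  constructor
  · rintro ⟨a, b, ⟨h, rfl⟩, rfl⟩; exact h
  · intro h; exact ⟨_, _, ⟨h, rfl⟩, rfl⟩

@[simp] theorem mem_rev {E : Finset (V × V)} {v w : V} : (v, w) ∈ rev E ↔ (w, v) ∈ E := by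
  simp only [rev, mem_image, Prod.exists, Prod.swap_prod_mk, Prod.mk.injEq]
  constructor
  · rintro ⟨a, b, h, rfl, rfl⟩; exact h
  · intro h; exact ⟨_, _, h, rfl, rfl⟩

theorem del_subset (E : Finset (V × V)) (S : Finset V) : del E S ⊆ E := filter_subset _ _

theorem ind_subset (E : Finset (V × V)) (S : Finset V) : ind E S ⊆ E := filter_subset _ _

theorem supp_mono {E F : Finset (V × V)} (h : E ⊆ F) : supp E ⊆ supp F := fun _ hv => by
  obtain ⟨w, hw⟩ := mem_supp.1 hv
  exact mem_supp.2 ⟨w, hw.imp (fun h' => h h') fun h' => h h'⟩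

theorem supp_subset_iff {E : Finset (V × V)} {S : Finset V} :
    supp E ⊆ S ↔ ∀ a ∈ E, a.1 ∈ S ∧ a.2 ∈ S := by
  refine ⟨fun h a ha => ⟨h (fst_mem_supp ha), h (snd_mem_supp ha)⟩, fun h v hv => ?_⟩
  obtain ⟨w, hw | hw⟩ := mem_supp.1 hv
  · exact (h _ hw).1
  · exact (h _ hw).2

theorem card_filter_fst (E : Finset (V × V)) (v : V) :
    #{a ∈ E | a.1 = v} = #(outN E v) := by
  rw [outN, card_image_of_injOn]
  rintro ⟨a, b⟩ ha ⟨c, d⟩ hc h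
  simp only [coe_filter, Set.mem_ofPred_eq] at ha hc h
  simp [ha.2, hc.2, h]

theorem card_filter_snd (E : Finset (V × V)) (v : V) :
    #{a ∈ E | a.2 = v} = #(inN E v) := by
  rw [inN, card_image_of_injOn]
  rintro ⟨a, b⟩ ha ⟨c, d⟩ hc h
  simp only [coe_filter, Set.mem_ofPred_eq] at ha hc h
  simp [ha.2, hc.2, h]

/-! ### Peeling off vertices that lie on no monochromatic cycle -/

/-- A vertex without successors, or without predecessors, cannot be an inner vertex of a walk. -/
theorem transGen_avoid {r : V → V → Prop} {S : Finset V}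
    (hS : ∀ v ∈ S, (∀ w, ¬ r v w) ∨ ∀ w, ¬ r w v) {a b : V} (h : Relation.TransGen r a b)
    (ha : a ∉ S) (hb : b ∉ S) :
    Relation.TransGen (fun x y => r x y ∧ x ∉ S ∧ y ∉ S) a b := by
  induction h with
  | single h => exact .single ⟨h, ha, hb⟩
  | tail h1 h ih =>
    rename_i b c
    have hb' : b ∉ S := fun hb' => by
      rcases hS b hb' with h' | h'
      · exact h' _ h
      · obtain ⟨d, -, hd⟩ := Relation.TransGen.tail'_iff.1 h1
        exact h' _ hd
    exact (ih hb').tail ⟨h, hb', hb⟩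

/-- If every vertex of `S` has no out-neighbour, or no in-neighbour, of its own colour, then the
arcs at `S` lie in no monochromatic cycle. -/
theorem Proper.of_del {E : Finset (V × V)} {C : Type*} {φ : V → C} {S : Finset V}
    (h : Proper (del E S) φ)
    (hS : ∀ v ∈ S, (∀ w, (v, w) ∈ E → φ w ≠ φ v) ∨ ∀ w, (w, v) ∈ E → φ w ≠ φ v) :
    Proper E φ := by
  intro v hv
  have hS' : ∀ v ∈ S, (∀ w, ¬ Mono E φ v w) ∨ ∀ w, ¬ Mono E φ w v := fun v hvS =>
    (hS v hvS).imp (fun h w hw => h w hw.1 hw.2.symm) (fun h w hw => h w hw.1 hw.2)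
  have hvS : v ∉ S := fun hvS => by
    rcases hS' v hvS with h' | h'
    · obtain ⟨d, hd, -⟩ := Relation.TransGen.head'_iff.1 hv
      exact h' _ hd
    · obtain ⟨d, -, hd⟩ := Relation.TransGen.tail'_iff.1 hv
      exact h' _ hd
  refine h v (Relation.TransGen.mono ?_ _ _ (transGen_avoid hS' hv hvS hvS))
  intro x y hxy
  exact ⟨mem_del.2 ⟨hxy.1.1, hxy.2.1, hxy.2.2⟩, hxy.1.2⟩

theorem Proper.of_del_out {E : Finset (V × V)} {C : Type*} {φ : V → C} {v : V}
    (h : Proper (del E {v}) φ) (hv : ∀ w, (v, w) ∈ E → φ w ≠ φ v) : Proper E φ :=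
  h.of_del fun u hu => by rw [mem_singleton] at hu; subst hu; exact Or.inl hv

theorem Proper.of_del_in {E : Finset (V × V)} {C : Type*} {φ : V → C} {v : V}
    (h : Proper (del E {v}) φ) (hv : ∀ w, (w, v) ∈ E → φ w ≠ φ v) : Proper E φ :=
  h.of_del fun u hu => by rw [mem_singleton] at hu; subst hu; exact Or.inr hv

/-- Colours outside the support do not matter. -/
theorem Proper.update {E : Finset (V × V)} {C : Type*} {φ : V → C} {v : V} (c : C)
    (h : Proper (del E {v}) φ) : Proper (del E {v}) (Function.update φ v c) :=
  h.congr fun a ha => by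
    simp only [mem_del, mem_singleton] at ha
    exact ⟨Function.update_of_ne ha.2.1 _ _, Function.update_of_ne ha.2.2 _ _⟩

theorem Proper.ne_of_digon {E : Finset (V × V)} {C : Type*} {φ : V → C} (h : Proper E φ) {u v : V}
    (h1 : (u, v) ∈ E) (h2 : (v, u) ∈ E) : φ u ≠ φ v := fun he =>
  h u ((Relation.TransGen.single (r := Mono E φ) ⟨h1, he⟩).tail ⟨h2, he.symm⟩)

/-! ### Reversal -/

theorem rev_rev (E : Finset (V × V)) : rev (rev E) = E := by
  ext ⟨a, b⟩; simp

theorem card_rev (E : Finset (V × V)) : #(rev E) = #E :=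
  card_image_of_injective _ Prod.swap_injective

theorem supp_rev (E : Finset (V × V)) : supp (rev E) = supp E := by
  ext v; simp only [mem_supp, mem_rev]; exact exists_congr fun _ => or_comm

theorem outN_rev (E : Finset (V × V)) (v : V) : outN (rev E) v = inN E v := by ext; simp

theorem inN_rev (E : Finset (V × V)) (v : V) : inN (rev E) v = outN E v := by ext; simp

theorem rev_subset {E F : Finset (V × V)} (h : E ⊆ F) : rev E ⊆ rev F := image_subset_image h

theorem Proper.rev {E : Finset (V × V)} {C : Type*} {φ : V → C} (h : Proper E φ) :
    Proper (rev E) φ := by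
  intro v hv
  refine h v (Relation.TransGen.swap _ _ (Relation.TransGen.mono ?_ _ _ hv))
  intro a b hab
  exact ⟨mem_rev.1 hab.1, hab.2.symm⟩

theorem Col.rev {n : ℕ} {E : Finset (V × V)} (h : Col n E) : Col n (rev E) :=
  h.imp fun _ => Proper.rev

theorem col_rev {n : ℕ} {E : Finset (V × V)} : Col n (ArcSet.rev E) ↔ Col n E :=
  ⟨fun h => rev_rev E ▸ h.rev, Col.rev⟩

/-! ### Critical digraphs -/

/-- `E` has no loops. -/
def Loopless (E : Finset (V × V)) : Prop := ∀ a ∈ E, a.1 ≠ a.2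

theorem Loopless.mono {E F : Finset (V × V)} (h : Loopless E) (hF : F ⊆ E) : Loopless F :=
  fun a ha => h a (hF ha)

theorem Loopless.union {E F : Finset (V × V)} (h : Loopless E) (hF : Loopless F) :
    Loopless (E ∪ F) := fun a ha => (mem_union.1 ha).elim (h a) (hF a)

theorem Loopless.rev {E : Finset (V × V)} (h : Loopless E) : Loopless (rev E) :=
  fun a ha => (h (a.2, a.1) (mem_rev.1 (by exact ha))).symm

/-- `E` is not dicolourable with `n` colours, but all its proper subsets are. -/
structure Crit (n : ℕ) (E : Finset (V × V)) : Prop where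
  not_col : ¬ Col n E
  col : ∀ F, F ⊂ E → Col n F

theorem Crit.rev {n : ℕ} {E : Finset (V × V)} (h : Crit n E) : Crit n (rev E) := by
  refine ⟨fun h' => h.not_col (col_rev.1 h'), fun F hF => col_rev.1 (h.col _ ?_)⟩
  refine ⟨fun a ha => ?_, fun hs => hF.2 fun a ha => ?_⟩
  · have := rev_subset hF.1 ha; rwa [rev_rev] at this
  · have := rev_subset hs ha; rwa [rev_rev] at this

theorem exists_crit {n : ℕ} {E : Finset (V × V)} (h : ¬ Col n E) : ∃ F ⊆ E, Crit n F := by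
  induction E using Finset.strongInduction with
  | H E ih =>
    by_cases hE : ∀ F, F ⊂ E → Col n F
    · exact ⟨E, Subset.refl _, h, hE⟩
    · push Not at hE
      obtain ⟨F, hF, hF'⟩ := hE
      obtain ⟨F', h1, h2⟩ := ih F hF hF'
      exact ⟨F', h1.trans hF.1, h2⟩

theorem Crit.col_del {n : ℕ} {E : Finset (V × V)} (h : Crit n E) {v : V} (hv : v ∈ supp E) :
    Col n (del E {v}) := by
  refine h.col _ ⟨del_subset _ _, fun hs => ?_⟩
  obtain ⟨w, hw | hw⟩ := mem_supp.1 hv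
  · have := hs hw; simp at this
  · have := hs hw; simp at this

theorem exists_color_notMem {n : ℕ} (φ : V → Fin n) {S : Finset V} (hS : #S < n) :
    ∃ c, ∀ w ∈ S, φ w ≠ c := by
  by_contra! h
  have : (univ : Finset (Fin n)) ⊆ S.image φ := fun c _ => by
    obtain ⟨w, hw, rfl⟩ := h c
    exact mem_image_of_mem _ hw
  have := (card_le_card this).trans card_image_le
  simp at this; omega

theorem col_of_del_out {n : ℕ} {E : Finset (V × V)} (hl : Loopless E) {v : V} {φ : V → Fin n}
    (h : Proper (del E {v}) φ) {c : Fin n} (hc : ∀ w ∈ outN E v, φ w ≠ c) : Col n E := by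
  refine ⟨Function.update φ v c, (h.update c).of_del_out fun w hw => ?_⟩
  rw [Function.update_of_ne (hl _ hw).symm, Function.update_self]
  exact hc w (mem_outN.2 hw)

/-- With fewer out-neighbours, `v` could take a colour that is absent from all of them. -/
theorem Crit.le_outN {n : ℕ} {E : Finset (V × V)} (h : Crit n E) (hl : Loopless E) {v : V}
    (hv : v ∈ supp E) : n ≤ #(outN E v) := by
  by_contra! hlt
  obtain ⟨φ, hφ⟩ := h.col_del hv
  obtain ⟨c, hc⟩ := exists_color_notMem φ hlt
  exact h.not_col (col_of_del_out hl hφ hc)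

theorem Crit.le_inN {n : ℕ} {E : Finset (V × V)} (h : Crit n E) (hl : Loopless E) {v : V}
    (hv : v ∈ supp E) : n ≤ #(inN E v) := by
  rw [← outN_rev]
  exact h.rev.le_outN hl.rev (by rwa [supp_rev])

/-- In a colouring of a critical digraph minus `x`, all colours occur among the out-neighbours
of `x`, so that they are pairwise differently coloured if there are only `n` of them. -/
theorem Crit.injOn_outN {n : ℕ} {E : Finset (V × V)} (h : Crit n E) (hl : Loopless E) {x : V}
    (hx : #(outN E x) = n) {φ : V → Fin n} (hφ : Proper (del E {x}) φ) :
    Set.InjOn φ (outN E x) := by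
  have hsurj : (outN E x).image φ = univ := by
    rw [eq_univ_iff_forall]
    intro c
    by_contra hc
    refine h.not_col (col_of_del_out hl hφ (c := c) fun w hw he => hc ?_)
    exact he ▸ mem_image_of_mem _ hw
  refine card_image_iff.1 ?_
  rw [hsurj, hx]; simp

/-! ### The potential and the minimal counterexample -/

/-- The potential of a digraph with `s` vertices and `m` arcs, scaled by `2 n`, where `n + 1` is the
dichromatic number in question. -/
def wt (n s m : ℕ) : ℤ := (2 * n ^ 2 + n - 2) * s - 2 * n * m

/-- The closed out- and in-neighbourhoods of a vertex. -/
def sig (E : Finset (V × V)) (v : V) : Finset V × Finset V :=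
  (insert v (outN E v), insert v (inN E v))

/-- The number of ordered pairs of vertices with the same closed neighbourhoods. -/
def twinCount (E : Finset (V × V)) : ℕ :=
  #{p ∈ supp E ×ˢ supp E | sig E p.1 = sig E p.2}

/-- `F` precedes `E` in the order used to choose a minimal counterexample. -/
def Smaller (F E : Finset (V × V)) : Prop :=
  #(supp F) < #(supp E) ∨ (#(supp F) = #(supp E) ∧
    (#F < #E ∨ (#F = #E ∧ twinCount E < twinCount F)))

/-- A smallest critical digraph that violates the bound on the number of arcs. -/
structure MinCounterexample (n : ℕ) (E : Finset (V × V)) : Prop where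
  loopless : Loopless E
  crit : Crit n E
  lt_wt : (n : ℤ) ^ 2 - n - 2 < wt n #(supp E) #E
  wt_le : ∀ F : Finset (V × V), Loopless F → Crit n F → Smaller F E →
    wt n #(supp F) #F ≤ (n : ℤ) ^ 2 - n - 2

/-! ### Cliques and cuts -/

/-- Any two vertices of `K` are joined by arcs in both directions. -/
def IsClique (E : Finset (V × V)) (K : Finset V) : Prop :=
  ∀ u ∈ K, ∀ v ∈ K, u ≠ v → (u, v) ∈ E

theorem ind_subset_offDiag {E : Finset (V × V)} (hl : Loopless E) (R : Finset V) :
    ind E R ⊆ R.offDiag := fun a ha => by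
  rw [mem_ind] at ha
  exact mem_offDiag.2 ⟨ha.2.1, ha.2.2, hl a ha.1⟩

theorem card_ind_le {E : Finset (V × V)} (hl : Loopless E) (R : Finset V) :
    (#(ind E R) : ℤ) ≤ #R * (#R - 1) := by
  have := card_le_card (ind_subset_offDiag hl R)
  rw [offDiag_card] at this
  have h2 : #R ≤ #R * #R := Nat.le_mul_self _
  zify [h2] at this
  linarith

theorem isClique_of_card_ind {E : Finset (V × V)} (hl : Loopless E) {R : Finset V}
    (h : (#R * (#R - 1) : ℤ) ≤ #(ind E R)) : IsClique E R := by
  have hle : #R.offDiag ≤ #(ind E R) := by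
    rw [offDiag_card]
    have h2 : #R ≤ #R * #R := Nat.le_mul_self _
    zify [h2]; linarith
  have heq := eq_of_subset_of_card_le (ind_subset_offDiag hl R) hle
  intro u hu v hv huv
  have : (u, v) ∈ ind E R := heq ▸ mem_offDiag.2 ⟨hu, hv, huv⟩
  exact (mem_ind.1 this).1

theorem IsClique.card_ind {E : Finset (V × V)} (hl : Loopless E) {R : Finset V}
    (h : IsClique E R) : (#(ind E R) : ℤ) = #R * (#R - 1) := by
  have : ind E R = R.offDiag := (ind_subset_offDiag hl R).antisymm fun a ha => by
    rw [mem_offDiag] at ha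
    exact mem_ind.2 ⟨h _ ha.1 _ ha.2.1 ha.2.2, ha.1, ha.2.1⟩
  rw [this, offDiag_card]
  have h2 : #R ≤ #R * #R := Nat.le_mul_self _
  push_cast [h2]; ring

theorem transGen_fiber {β : Type*} {r : V → V → Prop} (σ : V → β) {a b : V}
    (h : Relation.TransGen (fun x y => r x y ∧ σ x = σ y) a b) :
    σ b = σ a ∧ Relation.TransGen (fun x y => r x y ∧ σ x = σ a ∧ σ y = σ a) a b := by
  induction h with
  | single h => exact ⟨h.2.symm, .single ⟨h.1, rfl, h.2.symm⟩⟩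
  | tail _ h ih => exact ⟨h.2 ▸ ih.1, ih.2.tail ⟨h.1, ih.1, h.2 ▸ ih.1⟩⟩

/-- A closed walk that enters `R` must also leave it, so once no monochromatic arc leaves `R`, each
monochromatic cycle is inside `R` or avoids it. -/
theorem proper_of_no_cross {E : Finset (V × V)} {C : Type*} {χ : V → C} {R : Finset V}
    (h1 : Proper (ind E R) χ) (h2 : Proper (del E R) χ)
    (h : ∀ u v, (u, v) ∈ E → u ∈ R → v ∉ R → χ u ≠ χ v) : Proper E χ := by
  have hb : Proper ({(false, true)} : Finset (Bool × Bool)) (fun _ => ()) := by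
    intro v hv
    obtain ⟨c, hc, -⟩ := Relation.TransGen.head'_iff.1 hv
    obtain ⟨d, -, hd⟩ := Relation.TransGen.tail'_iff.1 hv
    have h1 := hc.1
    have h2 := hd.1
    simp only [mem_singleton, Prod.mk.injEq] at h1 h2
    exact absurd (h1.1.symm.trans h2.2) (by simp)
  refine hb.contract (fun v => decide (v ∈ R)) ?_ ?_
  · intro u v huv
    by_cases hu : u ∈ R <;> by_cases hv : v ∈ R
    · left; simp [hu, hv]
    · exact absurd huv.2 (h u v huv.1 hu hv)
    · right; exact ⟨by simp [hu, hv], rfl⟩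
    · left; simp [hu, hv]
  · intro v hv
    have := (transGen_fiber _ hv).2
    by_cases hvR : v ∈ R
    · refine h1 v (Relation.TransGen.mono ?_ _ _ this)
      rintro x y ⟨hxy, hx, hy⟩
      simp only [hvR, decide_true, decide_eq_true_eq] at hx hy
      exact ⟨mem_ind.2 ⟨hxy.1, hx, hy⟩, hxy.2⟩
    · refine h2 v (Relation.TransGen.mono ?_ _ _ this)
      rintro x y ⟨hxy, hx, hy⟩
      simp only [hvR, decide_false, decide_eq_false_iff_not] at hx hy
      exact ⟨mem_del.2 ⟨hxy.1, hx, hy⟩, hxy.2⟩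

/-- At least `n` arcs of a critical digraph leave a proper nonempty set of vertices. -/
theorem Crit.le_card_cut {n : ℕ} {E : Finset (V × V)} (h : Crit n E) {R : Finset V}
    (hR : R ⊂ supp E) (hR0 : R.Nonempty) : n ≤ #{a ∈ E | a.1 ∈ R ∧ a.2 ∉ R} := by
  by_contra! hlt
  have hn : NeZero n := ⟨by omega⟩
  obtain ⟨x, hx, hxR⟩ := exists_of_ssubset hR
  obtain ⟨y, hyR⟩ := hR0
  obtain ⟨φ, hφ⟩ : Col n (ind E R) := (h.col_del hx).mono fun a ha => by
    rw [mem_ind] at ha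
    refine mem_del.2 ⟨ha.1, ?_, ?_⟩ <;> rw [mem_singleton] <;> rintro rfl
    exacts [hxR ha.2.1, hxR ha.2.2]
  obtain ⟨ψ, hψ⟩ : Col n (del E R) := (h.col_del (hR.1 hyR)).mono fun a ha => by
    rw [mem_del] at ha
    refine mem_del.2 ⟨ha.1, ?_, ?_⟩ <;> rw [mem_singleton] <;> rintro rfl
    exacts [ha.2.1 hyR, ha.2.2 hyR]
  set S : Finset (V × V) := {a ∈ E | a.1 ∈ R ∧ a.2 ∉ R} with hS
  -- Each arc leaving `R` spoils one cyclic shift of the colours of `ψ`; there are fewer such arcs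
  -- than shifts.
  have hex : ∃ j : Fin n, ∀ a ∈ S, φ a.1 - ψ a.2 ≠ j := by
    by_contra! hc
    have h1 : (univ : Finset (Fin n)) ⊆
        S.image (fun a => φ a.1 - ψ a.2) := fun j _ => by
      obtain ⟨a, ha, rfl⟩ := hc j
      exact mem_image_of_mem _ ha
    have h2 := (card_le_card h1).trans card_image_le
    simp at h2; omega
  obtain ⟨j, hj⟩ := hex
  refine h.not_col ⟨fun v => if v ∈ R then φ v else ψ v + j, proper_of_no_cross (R := R) ?_ ?_ ?_⟩
  · refine hφ.congr fun a ha => ?_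
    rw [mem_ind] at ha
    simp [ha.2.1, ha.2.2]
  · intro v hv
    refine hψ v (Relation.TransGen.mono ?_ _ _ hv)
    intro a b hab
    have h1 := mem_del.1 hab.1
    have h2 := hab.2
    simp only [h1.2.1, h1.2.2, if_false, add_left_inj] at h2
    exact ⟨hab.1, h2⟩
  · intro u v huv hu hv he
    simp only [hu, hv, if_true, if_false] at he
    exact hj (u, v) (mem_filter.2 ⟨huv, hu, hv⟩) (by simp [he])

/-! ### Contraction of the colour classes of a coloured part -/

/-- The vertex of the contracted digraph that stands for `v`: the colour classes of `φ` on `R` are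
contracted to the vertices `nm i`. -/
def rep (R : Finset V) {n : ℕ} (φ : V → Fin n) (nm : Fin n → V) (v : V) : V :=
  if v ∈ R then nm (φ v) else v

/-- The digraph obtained from `E` by contracting the colour classes of `φ` on `R` and joining the
resulting vertices by all possible arcs. -/
def contr (E : Finset (V × V)) (R : Finset V) {n : ℕ} (φ : V → Fin n) (nm : Fin n → V) :
    Finset (V × V) :=
  (E.filter fun a => ¬ (a.1 ∈ R ∧ a.2 ∈ R)).image (fun a => (rep R φ nm a.1, rep R φ nm a.2)) ∪
    (univ.image nm).offDiag

section contr

variable {n : ℕ} {E : Finset (V × V)} {R : Finset V} {φ : V → Fin n} {nm : Fin n → V}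

theorem rep_of_mem {v : V} (hv : v ∈ R) : rep R φ nm v = nm (φ v) := if_pos hv

theorem rep_of_notMem {v : V} (hv : v ∉ R) : rep R φ nm v = v := if_neg hv

theorem rep_eq_iff (hnm : ∀ i, nm i ∈ R) (hinj : Function.Injective nm) {u v : V} (huv : u ≠ v) :
    rep R φ nm u = rep R φ nm v ↔ u ∈ R ∧ v ∈ R ∧ φ u = φ v := by
  by_cases hu : u ∈ R <;> by_cases hv : v ∈ R
  · simp [rep, hu, hv, hinj.eq_iff]
  · simp only [rep, hu, hv, if_true, if_false, true_and, false_and, iff_false]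
    rintro rfl; exact hv (hnm _)
  · simp only [rep, hu, hv, if_true, if_false, false_and, iff_false]
    rintro rfl; exact hu (hnm _)
  · simp [rep, hu, hv, huv]

theorem loopless_contr (hl : Loopless E) (hnm : ∀ i, nm i ∈ R) (hinj : Function.Injective nm) :
    Loopless (contr E R φ nm) := by
  intro a ha
  rw [contr, mem_union, mem_image] at ha
  rcases ha with ⟨b, hb, rfl⟩ | ha
  · rw [mem_filter] at hb
    rw [Ne, rep_eq_iff hnm hinj (hl b hb.1)]
    exact fun h => hb.2 ⟨h.1, h.2.1⟩
  · exact (mem_offDiag.1 ha).2.2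

/-- The added clique makes the contracted vertices differ in colour, so a colouring pulls back to
`E`. A monochromatic cycle inside one fibre would be a monochromatic cycle of `φ` on `R`. -/
theorem not_col_contr (h : ¬ Col n E) (hl : Loopless E) (hnm : ∀ i, nm i ∈ R)
    (hinj : Function.Injective nm) (hφ : Proper (ind E R) φ) : ¬ Col n (contr E R φ nm) := by
  rintro ⟨ψ, hψ⟩
  have hinj' : Function.Injective (fun i => ψ (nm i)) := by
    intro i j hij
    by_contra hne
    have hm : ∀ i, nm i ∈ univ.image nm := fun i => mem_image_of_mem _ (mem_univ _)
    exact hψ.ne_of_digon (u := nm i) (v := nm j)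
      (mem_union_right _ (mem_offDiag.2 ⟨hm _, hm _, hinj.ne hne⟩))
      (mem_union_right _ (mem_offDiag.2 ⟨hm _, hm _, hinj.ne (Ne.symm hne)⟩)) hij
  refine h ⟨fun v => ψ (rep R φ nm v), hψ.contract (rep R φ nm) ?_ ?_⟩
  · intro u v huv
    by_cases hb : u ∈ R ∧ v ∈ R
    · left
      have := huv.2
      simp only [rep_of_mem hb.1, rep_of_mem hb.2] at this ⊢
      rw [hinj' this]
    · right
      exact ⟨mem_union_left _ (mem_image.2 ⟨(u, v), mem_filter.2 ⟨huv.1, hb⟩, rfl⟩), huv.2⟩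
  · intro v hv
    refine hφ v (Relation.TransGen.mono ?_ _ _ hv)
    rintro x y ⟨hxy, he⟩
    have := (rep_eq_iff hnm hinj (hl _ hxy.1)).1 he
    exact ⟨mem_ind.2 ⟨hxy.1, this.1, this.2.1⟩, this.2.2⟩

theorem supp_contr_subset :
    supp (contr E R φ nm) ⊆ (supp E \ R) ∪ univ.image nm := by
  have key : ∀ v ∈ supp E, rep R φ nm v ∈ (supp E \ R) ∪ univ.image nm := by
    intro v hv
    by_cases hvR : v ∈ R
    · rw [rep_of_mem hvR]; exact mem_union_right _ (mem_image_of_mem _ (mem_univ _))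
    · rw [rep_of_notMem hvR]; exact mem_union_left _ (mem_sdiff.2 ⟨hv, hvR⟩)
  rw [supp_subset_iff]
  intro a ha
  rw [contr, mem_union, mem_image] at ha
  rcases ha with ⟨b, hb, rfl⟩ | ha
  · rw [mem_filter] at hb
    exact ⟨key _ (fst_mem_supp hb.1), key _ (snd_mem_supp hb.1)⟩
  · rw [mem_offDiag] at ha
    exact ⟨mem_union_right _ ha.1, mem_union_right _ ha.2.1⟩

end contr

/-! ### A combinatorial lemma on pairs -/

/-- A set of at least `2 m` items, each with an end: either some end is shared by `m` of them, or
`m` disjoint pairs of items with different ends exist. In both cases few pairs of ends meet every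
large set in a controlled way. -/
theorem exists_separating_pairs {ι : Type*} (C : Finset ι) (e : ι → V) (m : ℕ)
    (hC : 2 * m ≤ #C) :
    ∃ H : Finset (V × V), #H ≤ m ∧ (∀ p ∈ H, p.1 ≠ p.2 ∧ p.1 ∈ C.image e ∧ p.2 ∈ C.image e) ∧
      ∀ M : Set V, (∀ p ∈ H, ¬ (p.1 ∈ M ∧ p.2 ∈ M)) →
        (∃ u, ∀ i ∈ C, e i ∈ M → e i = u) ∨
          ∀ D : Finset ι, (∀ i ∈ C, e i ∉ M → i ∈ D) → m ≤ #D := by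
  classical
  -- If one end `u` carries `m` items, the pairs form a star from `u` to other ends. Otherwise the
  -- items are matched.
  by_cases hbig : ∃ u, u ∈ C.image e ∧ m ≤ #{i ∈ C | e i = u}
  · obtain ⟨u, huC, hu⟩ := hbig
    obtain ⟨B, hBsub, hB⟩ : ∃ B ⊆ (C.image e).erase u, #B = min m #((C.image e).erase u) :=
      exists_subset_card_eq (min_le_right _ _)
    refine ⟨B.image fun b => (u, b), card_image_le.trans (hB ▸ min_le_left _ _), ?_, ?_⟩
    · intro p hp
      obtain ⟨b, hb, rfl⟩ := mem_image.1 hp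
      have := mem_erase.1 (hBsub hb)
      exact ⟨this.1.symm, huC, this.2⟩
    · intro M hM
      by_cases huM : u ∈ M
      · have hBM : ∀ b ∈ B, b ∉ M := fun b hb hbM => hM (u, b) (mem_image_of_mem _ hb) ⟨huM, hbM⟩
        rcases le_total m #((C.image e).erase u) with hm | hm
        · right
          intro D hD
          have h1 : B ⊆ D.image e := fun b hb => by
            obtain ⟨i, hi, rfl⟩ := mem_image.1 (mem_of_mem_erase (hBsub hb))
            exact mem_image_of_mem _ (hD i hi (hBM _ hb))
          have := (card_le_card h1).trans card_image_le
          rw [hB, min_eq_left hm] at this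
          exact this
        · left
          refine ⟨u, fun i hi hiM => ?_⟩
          by_contra hne
          have : B = (C.image e).erase u :=
            eq_of_subset_of_card_le hBsub (by rw [hB, min_eq_right hm])
          exact hBM (e i) (this ▸ mem_erase.2 ⟨hne, mem_image_of_mem _ hi⟩) hiM
      · right
        intro D hD
        refine hu.trans (card_le_card fun i hi => ?_)
        rw [mem_filter] at hi
        exact hD i hi.1 (hi.2 ▸ huM)
  · push Not at hbig
    let N := #C
    let idx : Fin N ≃ C := C.equivFin.symm
    let rk : V → ℕ := fun v => if h : v ∈ C.image e then ((C.image e).equivFin ⟨v, h⟩ : ℕ) else 0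
    have hrk : ∀ i ∈ C, ∀ j ∈ C, rk (e i) = rk (e j) → e i = e j := by
      intro i hi j hj hij
      have h1 := mem_image_of_mem e hi
      have h2 := mem_image_of_mem e hj
      simp only [rk, dif_pos h1, dif_pos h2] at hij
      have := (C.image e).equivFin.injective (Fin.ext hij)
      exact congrArg Subtype.val this
    let g : Fin N → ℕ := fun p => rk (e (idx p))
    let s := Tuple.sort g
    have hs : Monotone (g ∘ s) := Tuple.monotone_sort g
    let it : Fin N → ι := fun p => (idx (s p) : ι)
    have hit : Function.Injective it :=
      Subtype.val_injective.comp (idx.injective.comp s.injective)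
    have hitC : ∀ p, it p ∈ C := fun p => (idx (s p)).2
    have hlo : ∀ p : Fin m, (p : ℕ) < N := fun p => by have := p.2; omega
    have hhi : ∀ p : Fin m, (p : ℕ) + m < N := fun p => by have := p.2; omega
    -- In the order sorted by ends, item `p` is matched with item `p + m`. Equal ends would put `m +
    -- 1` consecutive items at one end.
    let a : Fin m → ι := fun p => it ⟨p, hlo p⟩
    let b : Fin m → ι := fun p => it ⟨p + m, hhi p⟩
    have hne : ∀ p, e (a p) ≠ e (b p) := by
      intro p hp
      have hsub : (univ : Finset (Fin (m + 1))).image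
          (fun j : Fin (m + 1) => it ⟨p + j, by have := j.2; have := p.2; omega⟩) ⊆
          {i ∈ C | e i = e (a p)} := by
        intro i hi
        obtain ⟨j, -, rfl⟩ := mem_image.1 hi
        refine mem_filter.2 ⟨hitC _, hrk _ (hitC _) _ (hitC _) (le_antisymm ?_ ?_)⟩
        · have h1 := hs (a := ⟨p + j, by have := j.2; have := p.2; omega⟩) (b := ⟨p + m, hhi p⟩)
            (by rw [Fin.mk_le_mk]; have := j.2; omega)
          rw [hp]
          exact h1
        · have h1 := hs (a := ⟨p, hlo p⟩) (b := ⟨p + j, by have := j.2; have := p.2; omega⟩)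
            (by rw [Fin.mk_le_mk]; omega)
          exact h1
      have h2 := card_le_card hsub
      rw [card_image_of_injective] at h2
      · simp only [card_univ, Fintype.card_fin] at h2
        have := hbig (e (a p)) (mem_image_of_mem _ (hitC _))
        omega
      · intro j k hjk
        have := congrArg Fin.val (hit hjk)
        simp only at this
        exact Fin.ext (by omega)
    refine ⟨univ.image fun p => (e (a p), e (b p)), ?_, ?_, ?_⟩
    · exact card_image_le.trans (by simp)
    · intro p hp
      obtain ⟨q, -, rfl⟩ := mem_image.1 hp
      exact ⟨hne q, mem_image_of_mem _ (hitC _), mem_image_of_mem _ (hitC _)⟩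
    · intro M hM
      right
      intro D hD
      have hM' : ∀ p, e (a p) ∈ M → e (b p) ∉ M := fun p h1 h2 =>
        hM _ (mem_image_of_mem _ (mem_univ p)) ⟨h1, h2⟩
      let f : Fin m → ι := fun p => if e (a p) ∈ M then b p else a p
      have hf : Function.Injective f := by
        intro p q hpq
        by_cases hp : e (a p) ∈ M <;> by_cases hq : e (a q) ∈ M <;>
          simp only [f, hp, hq, if_true, if_false] at hpq <;>
          (have := congrArg Fin.val (hit hpq); simp only at this
           have := p.2; have := q.2; exact Fin.ext (by omega))
      have hfD : univ.image f ⊆ D := by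
        intro i hi
        obtain ⟨p, -, rfl⟩ := mem_image.1 hi
        by_cases hp : e (a p) ∈ M
        · simp only [f, hp, if_true]; exact hD _ (hitC _) (hM' p hp)
        · simp only [f, hp, if_false]; exact hD _ (hitC _) hp
      have := card_le_card hfD
      rwa [card_image_of_injective _ hf, card_univ, Fintype.card_fin] at this

/-! ### The potential of proper vertex subsets -/

/-- The arcs between `R` and its complement. -/
def cross (E : Finset (V × V)) (R : Finset V) : Finset (V × V) :=
  E.filter fun a => ¬ (a.1 ∈ R ↔ a.2 ∈ R)

/-- The end in `R` of an arc between `R` and its complement. -/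
def inner (R : Finset V) (a : V × V) : V := if a.1 ∈ R then a.1 else a.2

theorem inner_mem {E : Finset (V × V)} {R : Finset V} {a : V × V} (ha : a ∈ cross E R) :
    inner R a ∈ R := by
  have h := (mem_filter.1 ha).2
  unfold inner
  split_ifs with h1
  · exact h1
  · tauto

theorem ind_supp (E : Finset (V × V)) : ind E (supp E) = E :=
  (ind_subset _ _).antisymm fun _ ha => mem_ind.2 ⟨ha, fst_mem_supp ha, snd_mem_supp ha⟩

theorem Crit.exists_mem {n : ℕ} [NeZero n] {E : Finset (V × V)} (h : Crit n E) : E.Nonempty := by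
  by_contra hE
  rw [not_nonempty_iff_eq_empty] at hE
  refine h.not_col ⟨fun _ => 0, fun v hv => ?_⟩
  obtain ⟨c, hc, -⟩ := Relation.TransGen.head'_iff.1 hv
  have := hc.1
  rw [hE] at this
  exact absurd this (notMem_empty _)

/-- What remains possible for a colouring of a set of vertices of least potential. -/
theorem MinCounterexample.of_coloring {n : ℕ} {E : Finset (V × V)} (h : MinCounterexample n E)
    (hn : 4 ≤ n) {R : Finset V} (hR : R ⊂ supp E) (hRn : n + 1 ≤ #R)
    (hmin : ∀ R' ⊂ supp E, 2 ≤ #R' → wt n #R #(ind E R) ≤ wt n #R' #(ind E R'))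
    (hle : wt n #R #(ind E R) ≤ n * (3 * n - 2)) {φ : V → Fin n} (hφ : Proper (ind E R) φ) :
    ∃ c, (¬ ∃ u, ∀ a ∈ cross E R, φ (inner R a) = c → inner R a = u) ∧
      2 * n * (#{a ∈ cross E R | φ (inner R a) ≠ c} : ℤ) <
        wt n #R #(ind E R) - (2 * n ^ 2 + n - 2) := by
  have hn0 : NeZero n := ⟨by omega⟩
  have hl := h.loopless
  have hnR : n ≤ #R := by omega
  obtain ⟨nm, hnm, hinj⟩ : ∃ nm : Fin n → V, (∀ i, nm i ∈ R) ∧ Function.Injective nm :=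
    ⟨fun i => (R.equivFin.symm (Fin.castLE hnR i) : V), fun i => coe_mem _,
      Subtype.val_injective.comp (R.equivFin.symm.injective.comp (Fin.castLE_injective hnR))⟩
  obtain ⟨W, hW, hWc⟩ := exists_crit (not_col_contr h.crit.not_col hl hnm hinj hφ)
  have hWl : Loopless W := (loopless_contr hl hnm hinj).mono hW
  set X := univ.image nm with hX
  have hXR : X ⊆ R := fun v hv => by
    obtain ⟨i, -, rfl⟩ := mem_image.1 hv
    exact hnm i
  have hXc : #X = n := by rw [hX, card_image_of_injective _ hinj]; simp
  have hWs : supp W ⊆ (supp E \ R) ∪ X := (supp_mono hW).trans supp_contr_subset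
  have hsub := card_sdiff_add_card_eq_card hR.1
  have hWsmall : #(supp W) < #(supp E) := by
    have := (card_le_card hWs).trans (card_union_le _ _)
    omega
  have hWP := h.wt_le W hWl hWc (Or.inl hWsmall)
  have hWarc : ∀ p ∈ W, (∃ a ∈ E, ¬ (a.1 ∈ R ∧ a.2 ∈ R) ∧ (rep R φ nm a.1, rep R φ nm a.2) = p) ∨
      p ∈ (supp W ∩ X).offDiag := by
    intro p hp
    have := hW hp
    rw [contr, mem_union, mem_image] at this
    rcases this with ⟨a, ha, hap⟩ | hp'
    · rw [mem_filter] at ha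
      exact Or.inl ⟨a, ha.1, ha.2, hap⟩
    · rw [mem_offDiag] at hp'
      exact Or.inr (mem_offDiag.2 ⟨mem_inter.2 ⟨fst_mem_supp hp, hp'.1⟩,
        mem_inter.2 ⟨snd_mem_supp hp, hp'.2.1⟩, hp'.2.2⟩)
  set i := #(supp W ∩ X) with hi
  have hin : i ≤ n := hXc ▸ card_le_card inter_subset_right
  have hrepX : ∀ v ∈ R, rep R φ nm v ∈ X := fun v hv => by
    rw [rep_of_mem hv]; exact mem_image_of_mem _ (mem_univ _)
  -- If `W` missed all contracted vertices, it would be a part of `E` avoiding a vertex of `R`,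
  -- hence colourable.
  have hi1 : 1 ≤ i := by
    by_contra! hi0
    have hemp : supp W ∩ X = ∅ := by rw [← card_eq_zero]; omega
    have hnotX : ∀ v ∈ supp W, v ∉ X := fun v hv hvX =>
      absurd (mem_inter.2 ⟨hv, hvX⟩) (by rw [hemp]; exact notMem_empty _)
    obtain ⟨y, hy⟩ : R.Nonempty := card_pos.1 (by omega)
    refine hWc.not_col ((h.crit.col_del (hR.1 hy)).mono fun p hp => ?_)
    rcases hWarc p hp with ⟨a, haE, -, rfl⟩ | hp'
    · have h1 : a.1 ∉ R := fun hh => hnotX _ (fst_mem_supp hp) (hrepX _ hh)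
      have h2 : a.2 ∉ R := fun hh => hnotX _ (snd_mem_supp hp) (hrepX _ hh)
      rw [rep_of_notMem h1, rep_of_notMem h2]
      refine mem_del.2 ⟨haE, ?_, ?_⟩ <;> rw [mem_singleton] <;> rintro rfl
      exacts [h1 hy, h2 hy]
    · rw [hemp] at hp'; simp at hp'
  set L := E.filter (fun a => ¬ (a.1 ∈ R ∧ a.2 ∈ R) ∧ (rep R φ nm a.1, rep R φ nm a.2) ∈ W)
    with hL
  have hWcard : (#W : ℤ) ≤ i * (i - 1) + #L := by
    have hs : W ⊆ (supp W ∩ X).offDiag ∪ L.image (fun a => (rep R φ nm a.1, rep R φ nm a.2)) := by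
      intro p hp
      rcases hWarc p hp with ⟨a, haE, haR, rfl⟩ | hp'
      · exact mem_union_right _ (mem_image_of_mem _ (mem_filter.2 ⟨haE, haR, hp⟩))
      · exact mem_union_left _ hp'
    have h1 := (card_le_card hs).trans (card_union_le _ _)
    have h2 : #(L.image (fun a => (rep R φ nm a.1, rep R φ nm a.2))) ≤ #L := card_image_le
    rw [offDiag_card, ← hi] at h1
    have h3 : i ≤ i * i := Nat.le_mul_self _
    zify [h3] at h1 h2
    linarith
  set T := supp W \ X with hT
  have hTout : ∀ v ∈ T, v ∈ supp E \ R := fun v hv => by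
    rw [hT, mem_sdiff] at hv
    exact (mem_union.1 (hWs hv.1)).resolve_right hv.2
  have hdisj : Disjoint R T := disjoint_left.2 fun v hv hvT => (mem_sdiff.1 (hTout v hvT)).2 hv
  have hR'card : (#(R ∪ T) : ℤ) = #R + #(supp W) - i := by
    rw [card_union_of_disjoint hdisj]
    have := card_inter_add_card_sdiff (supp W) X
    push_cast
    zify at this
    linarith
  have hLsub : L ⊆ ind E (R ∪ T) := by
    intro a ha
    rw [hL, mem_filter] at ha
    have key : ∀ v, rep R φ nm v ∈ supp W → v ∈ R ∪ T := by
      intro v hv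
      by_cases hvR : v ∈ R
      · exact mem_union_left _ hvR
      · rw [rep_of_notMem hvR] at hv
        exact mem_union_right _ (mem_sdiff.2 ⟨hv, fun hh => hvR (hXR hh)⟩)
    exact mem_ind.2 ⟨ha.1, key _ (fst_mem_supp ha.2.2), key _ (snd_mem_supp ha.2.2)⟩
  have hdL : Disjoint (ind E R) L := disjoint_left.2 fun a ha haL => by
    rw [hL, mem_filter] at haL
    exact haL.2.1 (mem_ind.1 ha).2
  have hcard1 : #(ind E R) + #L ≤ #(ind E (R ∪ T)) := by
    rw [← card_union_of_disjoint hdL]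
    refine card_le_card (union_subset (fun a ha => ?_) hLsub)
    rw [mem_ind] at ha ⊢
    exact ⟨ha.1, mem_union_left _ ha.2.1, mem_union_left _ ha.2.2⟩
  have hRT : R ∪ T ⊆ supp E := union_subset hR.1 fun v hv => (mem_sdiff.1 (hTout v hv)).1
  have hnz : (4 : ℤ) ≤ n := by exact_mod_cast hn
  have hi1z : (1 : ℤ) ≤ i := by exact_mod_cast hi1
  have hinz : (i : ℤ) ≤ n := by exact_mod_cast hin
  have hL0 : (0 : ℤ) ≤ 2 * n := by positivity
  have hwW := mul_le_mul_of_nonneg_left hWcard hL0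
  -- Counting arcs gives wt(R ∪ T) ≤ wt(R) + wt(W) - wt(K_i). Cliques of order 1 ≤ i ≤ n have
  -- potential above n² - n - 2 ≥ wt(W), so a proper `R ∪ T` would have smaller potential than `R`.
  have hRTeq : R ∪ T = supp E := by
    by_contra hne
    have h1 := hmin (R ∪ T) (hRT.ssubset_of_ne hne)
      (le_trans (by omega) (card_le_card subset_union_left))
    simp only [wt] at h1 hWP
    rw [hR'card] at h1
    have h2 : (2 * n : ℤ) * (#(ind E R) + #L) ≤ 2 * n * #(ind E (R ∪ T)) :=
      mul_le_mul_of_nonneg_left (by exact_mod_cast hcard1) hL0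
    have h3 : (2 * (n : ℤ) ^ 2 + n - 2) * i - 2 * n * (i * (i - 1)) ≤ n ^ 2 - n - 2 := by
      linarith
    nlinarith [mul_nonneg (mul_nonneg hL0 (sub_nonneg.2 hi1z)) (sub_nonneg.2 hinz)]
  rw [hRTeq, ind_supp] at hcard1
  rw [hRTeq] at hR'card
  have hgt := h.lt_wt
  -- Now wt(E) > n² - n - 2 ≥ wt(W) yields wt(K_i) < wt(R) ≤ n(3n - 2), which fails for 2 ≤ i ≤ n.
  have hi_eq : i = 1 := by
    by_contra hne
    have hi2 : (2 : ℤ) ≤ i := by exact_mod_cast (show 2 ≤ i by omega)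
    simp only [wt] at hgt hWP hle
    rw [hR'card] at hgt
    have h2 : (2 * n : ℤ) * (#(ind E R) + #L) ≤ 2 * n * #E :=
      mul_le_mul_of_nonneg_left (by exact_mod_cast hcard1) hL0
    have h3 : (2 * (n : ℤ) ^ 2 + n - 2) * i - 2 * n * (i * (i - 1)) < n * (3 * n - 2) := by
      linarith
    nlinarith [mul_nonneg (mul_nonneg hL0 (sub_nonneg.2 hi2)) (sub_nonneg.2 hinz)]
  obtain ⟨x, hx⟩ := card_eq_one.1 (hi.symm.trans hi_eq)
  obtain ⟨c, -, hc⟩ := mem_image.1 (mem_inter.1 (hx ▸ mem_singleton_self x)).2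
  have hWX : ∀ v ∈ R, rep R φ nm v ∈ supp W → φ v = c := by
    intro v hv hvW
    have h1 : rep R φ nm v ∈ supp W ∩ X := mem_inter.2 ⟨hvW, hrepX v hv⟩
    rw [hx, mem_singleton, rep_of_mem hv, ← hc] at h1
    exact hinj h1
  have hcrossW : ∀ a ∈ E, ¬ (a.1 ∈ R ∧ a.2 ∈ R) → (rep R φ nm a.1, rep R φ nm a.2) ∈ W →
      a ∈ cross E R → φ (inner R a) = c := by
    intro a _ _ haW hac
    unfold inner
    split_ifs with h1
    · exact hWX _ h1 (fst_mem_supp haW)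
    · have : a.2 ∈ R := by have := (mem_filter.1 hac).2; tauto
      exact hWX _ this (snd_mem_supp haW)
  refine ⟨c, ?_, ?_⟩
  · rintro ⟨u, hu⟩
    -- Sending the one contracted vertex of `W` back to `u` maps `W` into `E` without some arc at
    -- `r`, which is colourable.
    obtain ⟨r, hr, hru⟩ : ∃ r ∈ R, r ≠ u := by
      by_contra! hall
      have : R ⊆ {u} := fun r hr => mem_singleton.2 (hall r hr)
      have := card_le_card this
      simp at this; omega
    obtain ⟨f, hfE, hfr⟩ : ∃ f ∈ E, f.1 = r ∨ f.2 = r := by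
      obtain ⟨w, hw | hw⟩ := mem_supp.1 (hR.1 hr)
      · exact ⟨_, hw, Or.inl rfl⟩
      · exact ⟨_, hw, Or.inr rfl⟩
    obtain ⟨ψ, hψ⟩ := h.crit.col _ (erase_ssubset hfE)
    refine hWc.not_col ⟨_, hψ.comap (fun v => if v ∈ X then u else v) ?_⟩
    intro p hp
    rcases hWarc p hp with ⟨a, haE, haR, rfl⟩ | hp'
    · have hin : ∀ v ∈ R, rep R φ nm v ∈ supp W → inner R a = v → a ∈ cross E R → v = u := by
        intro v hv hvW hav hac
        rw [← hav]
        exact hu a hac (hav ▸ hWX v hv hvW)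
      have e1 : (if rep R φ nm a.1 ∈ X then u else rep R φ nm a.1) = a.1 ∧ (a.1 ∈ R → a.1 = u) := by
        by_cases h1 : a.1 ∈ R
        · have := hin a.1 h1 (fst_mem_supp hp) (by simp [inner, h1])
            (mem_filter.2 ⟨haE, by tauto⟩)
          exact ⟨by rw [if_pos (hrepX a.1 h1), this], fun _ => this⟩
        · rw [rep_of_notMem h1]
          rw [if_neg fun hh => h1 (hXR hh)]
          exact ⟨rfl, fun hh => absurd hh h1⟩
      have e2 : (if rep R φ nm a.2 ∈ X then u else rep R φ nm a.2) = a.2 ∧ (a.2 ∈ R → a.2 = u) := by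
        by_cases h1 : a.2 ∈ R
        · have h2 : a.1 ∉ R := fun hh => haR ⟨hh, h1⟩
          have := hin a.2 h1 (snd_mem_supp hp) (by simp [inner, h2])
            (mem_filter.2 ⟨haE, by tauto⟩)
          exact ⟨by rw [if_pos (hrepX a.2 h1), this], fun _ => this⟩
        · rw [rep_of_notMem h1]
          rw [if_neg fun hh => h1 (hXR hh)]
          exact ⟨rfl, fun hh => absurd hh h1⟩
      simp only
      rw [e1.1, e2.1]
      refine mem_erase.2 ⟨?_, haE⟩
      rintro rfl
      rcases hfr with rfl | rfl
      · exact hru (e1.2 hr)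
      · exact hru (e2.2 hr)
    · rw [hx] at hp'; simp at hp'
  -- Arcs of `Z` lie neither in `R` nor behind `W`, so each of them improves the estimate of wt(E)
  -- by 2n.
  · set Z := {a ∈ cross E R | φ (inner R a) ≠ c} with hZ
    have hZE : ∀ a ∈ Z, a ∈ cross E R := fun a ha => (mem_filter.1 ha).1
    have d1 : Disjoint (ind E R ∪ L) Z := disjoint_left.2 fun a ha haZ => by
      have hac := hZE a haZ
      rcases mem_union.1 ha with h1 | h1
      · have := (mem_filter.1 hac).2
        have := (mem_ind.1 h1).2
        tauto
      · rw [hL, mem_filter] at h1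
        exact (mem_filter.1 haZ).2 (hcrossW a h1.1 h1.2.1 h1.2.2 hac)
    have h4 : #(ind E R) + #L + #Z ≤ #E := by
      rw [← card_union_of_disjoint hdL, ← card_union_of_disjoint d1]
      refine card_le_card (union_subset (union_subset (ind_subset _ _) (filter_subset _ _)) ?_)
      exact fun a ha => (mem_filter.1 (hZE a ha)).1
    simp only [wt] at hgt hWP ⊢
    rw [hR'card] at hgt
    have h2 : (2 * n : ℤ) * (#(ind E R) + #L + #Z) ≤ 2 * n * #E :=
      mul_le_mul_of_nonneg_left (by exact_mod_cast h4) hL0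
    rw [hi_eq] at hgt hwW
    push_cast at hgt hwW
    linarith

/-- Every set of at least two, but not all, vertices of a minimal counterexample has large
potential. -/
theorem MinCounterexample.lt_wt_ind {n : ℕ} {E : Finset (V × V)} (h : MinCounterexample n E)
    (hn : 4 ≤ n) {R : Finset V} (hR : R ⊂ supp E) (hR2 : 2 ≤ #R) :
    (n : ℤ) * (3 * n - 2) < wt n #R #(ind E R) ∨ (#R = n ∧ IsClique E R) := by
  classical
  have hl := h.loopless
  have hnz : (4 : ℤ) ≤ n := by exact_mod_cast hn
  by_contra hcon
  push Not at hcon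
  obtain ⟨R, hRB, hRmin⟩ := exists_min_image
    {R ∈ (supp E).powerset | R ≠ supp E ∧ 2 ≤ #R ∧ ¬ (#R = n ∧ IsClique E R)}
    (fun R => wt n #R #(ind E R))
    ⟨R, by
      rw [mem_filter, mem_powerset]
      exact ⟨hR.1, hR.ne, hR2, fun hh => hcon.2 hh.1 hh.2⟩⟩
  have hle : wt n #R #(ind E R) ≤ n * (3 * n - 2) := by
    refine le_trans (hRmin _ ?_) hcon.1
    rw [mem_filter, mem_powerset]
    exact ⟨hR.1, hR.ne, hR2, fun hh => hcon.2 hh.1 hh.2⟩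
  clear hcon
  rw [mem_filter, mem_powerset] at hRB
  obtain ⟨hRsub, hRne, hR2, hRcl⟩ := hRB
  have hR : R ⊂ supp E := hRsub.ssubset_of_ne hRne
  -- The excluded cliques of order `n` have potential exactly n(3n - 2), so `R` is minimal among
  -- them too.
  have hmin : ∀ R' ⊂ supp E, 2 ≤ #R' → wt n #R #(ind E R) ≤ wt n #R' #(ind E R') := by
    intro R' hR' hR'2
    by_cases hcl : #R' = n ∧ IsClique E R'
    · refine hle.trans (le_of_eq ?_)
      rw [wt, hcl.2.card_ind hl, hcl.1]
      ring
    · exact hRmin R' (by rw [mem_filter, mem_powerset]; exact ⟨hR'.1, hR'.ne, hR'2, hcl⟩)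
  have hRn : n + 1 ≤ #R := by
    by_contra! hlt
    have h1 := card_ind_le hl R
    have hR2z : (2 : ℤ) ≤ #R := by exact_mod_cast hR2
    have hRnz : (#R : ℤ) ≤ n := by exact_mod_cast (show #R ≤ n by omega)
    rw [wt] at hle
    have h2 := mul_le_mul_of_nonneg_left h1 (show (0 : ℤ) ≤ 2 * n by positivity)
    by_cases hRn : #R = n
    · refine hRcl ⟨hRn, isClique_of_card_ind hl ?_⟩
      rw [hRn] at hle ⊢
      by_contra! hlt'
      nlinarith
    · have hRnz' : (#R : ℤ) + 1 ≤ n := by exact_mod_cast (show #R + 1 ≤ n by omega)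
      nlinarith [mul_nonneg (mul_nonneg (show (0 : ℤ) ≤ 2 * n by positivity)
        (sub_nonneg.2 hR2z)) (sub_nonneg.2 hRnz')]
  obtain ⟨x, hx, hxR⟩ := exists_of_ssubset hR
  obtain ⟨φ₀, hφ₀⟩ : Col n (ind E R) := (h.crit.col_del hx).mono fun a ha => by
    rw [mem_ind] at ha
    refine mem_del.2 ⟨ha.1, ?_, ?_⟩ <;> rw [mem_singleton] <;> rintro rfl
    exacts [hxR ha.2.1, hxR ha.2.2]
  have hpos : 2 * (n : ℤ) ^ 2 + n - 2 < wt n #R #(ind E R) := by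
    obtain ⟨c, -, hc⟩ := h.of_coloring hn hR hRn hmin hle hφ₀
    have : (0 : ℤ) ≤ 2 * n * (#{a ∈ cross E R | φ₀ (inner R a) ≠ c} : ℤ) := by positivity
    linarith
  -- `i` is (wt(R) - (2n² + n - 2)) / 2n rounded up. With `i` crossing arcs off colour `c`, the
  -- inequality of `of_coloring` fails; on the other hand 2i < n, so the cut has enough arcs to
  -- choose pairs from.
  obtain ⟨i, hi1, hi2⟩ : ∃ i : ℕ, wt n #R #(ind E R) - (2 * n ^ 2 + n - 2) ≤ 2 * n * i ∧
      2 * (n : ℤ) * i ≤ wt n #R #(ind E R) - (2 * n ^ 2 + n - 2) + 2 * n - 1 := by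
    obtain ⟨d, hd⟩ := Int.eq_ofNat_of_zero_le (sub_nonneg.2 hpos.le)
    rw [hd]
    refine ⟨(d + 2 * n - 1) / (2 * n), ?_, ?_⟩
    · have h1 := Nat.lt_mul_div_succ (d + 2 * n - 1) (show 0 < 2 * n by omega)
      rw [mul_add, mul_one] at h1
      have h2 : d ≤ 2 * n * ((d + 2 * n - 1) / (2 * n)) := by omega
      exact_mod_cast h2
    · have h1 := Nat.mul_div_le (d + 2 * n - 1) (2 * n)
      have h2 : 2 * n * ((d + 2 * n - 1) / (2 * n)) + 1 ≤ d + 2 * n := by omega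
      have h3 : (2 * (n : ℤ) * ((d + 2 * n - 1) / (2 * n) : ℕ) + 1 ≤ d + 2 * n) := by
        exact_mod_cast h2
      linarith
  have hcut : 2 * i ≤ #(cross E R) := by
    have h1 := h.crit.le_card_cut hR (card_pos.1 (by omega))
    have h2 : #{a ∈ E | a.1 ∈ R ∧ a.2 ∉ R} ≤ #(cross E R) := by
      refine card_le_card fun a ha => ?_
      rw [mem_filter] at ha
      exact mem_filter.2 ⟨ha.1, by tauto⟩
    have h3 : (2 * i : ℤ) < n := by
      by_contra! hge
      nlinarith
    have h4 : 2 * i < n := by exact_mod_cast h3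
    omega
  obtain ⟨H, hHi, hHR, hH⟩ := exists_separating_pairs (cross E R) (inner R) i hcut
  have hHR' : ∀ p ∈ H, p.1 ∈ R ∧ p.2 ∈ R := by
    intro p hp
    have := hHR p hp
    obtain ⟨a, ha, ha'⟩ := mem_image.1 this.2.1
    obtain ⟨b, hb, hb'⟩ := mem_image.1 this.2.2
    exact ⟨ha' ▸ inner_mem ha, hb' ▸ inner_mem hb⟩
  -- A critical subset would live on a proper vertex set of potential at most n² - n - 2 + 4ni, and
  -- this is less than wt(R).
  have hcol : Col n (ind E R ∪ (H ∪ rev H)) := by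
    by_contra hnot
    obtain ⟨W, hW, hWc⟩ := exists_crit hnot
    have hWl : Loopless W := by
      refine Loopless.mono ?_ hW
      have hHl : Loopless H := fun p hp => (hHR p hp).1
      exact (hl.mono (ind_subset _ _)).union (hHl.union hHl.rev)
    have hWR : supp W ⊆ R := by
      rw [supp_subset_iff]
      intro a ha
      have := hW ha
      rw [mem_union, mem_union] at this
      rcases this with h1 | h1 | h1
      · exact (mem_ind.1 h1).2
      · exact hHR' a h1
      · exact (hHR' (a.2, a.1) (mem_rev.1 (by exact h1))).symm
    have hWs : supp W ⊂ supp E := hWR.trans_ssubset hR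
    have hWP := h.wt_le W hWl hWc (Or.inl (card_lt_card hWs))
    have hn0 : NeZero n := ⟨by omega⟩
    obtain ⟨a, ha⟩ := hWc.exists_mem
    have hW2 : 2 ≤ #(supp W) := by
      have : ({a.1, a.2} : Finset V) ⊆ supp W := by
        intro v hv
        rw [mem_insert, mem_singleton] at hv
        rcases hv with rfl | rfl
        exacts [fst_mem_supp ha, snd_mem_supp ha]
      have h1 := card_le_card this
      rwa [card_pair (hWl a ha)] at h1
    have h1 := hmin _ hWs hW2
    have h2 : #W ≤ #(ind E (supp W)) + 2 * i := by
      have hs : W ⊆ ind E (supp W) ∪ (H ∪ rev H) := fun a ha => by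
        rcases mem_union.1 (hW ha) with h1 | h1
        · exact mem_union_left _ (mem_ind.2 ⟨(mem_ind.1 h1).1, fst_mem_supp ha, snd_mem_supp ha⟩)
        · exact mem_union_right _ h1
      have h3 := (card_le_card hs).trans (card_union_le _ _)
      have h4 := card_union_le H (rev H)
      rw [card_rev] at h4
      omega
    rw [wt] at hWP
    have h3 : wt n #(supp W) #(ind E (supp W)) =
      (2 * n ^ 2 + n - 2) * #(supp W) - 2 * n * #(ind E (supp W)) := rfl
    have h2z : (#W : ℤ) ≤ #(ind E (supp W)) + 2 * i := by exact_mod_cast h2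
    have h4 := mul_le_mul_of_nonneg_left h2z (show (0 : ℤ) ≤ 2 * n by positivity)
    nlinarith
  obtain ⟨φ, hφ⟩ := hcol
  obtain ⟨c, hc1, hc2⟩ := h.of_coloring hn hR hRn hmin hle (hφ.mono subset_union_left)
  rcases hH {v | φ v = c} (fun p hp hM => hφ.ne_of_digon
    (mem_union_right _ (mem_union_left _ hp))
    (mem_union_right _ (mem_union_right _ (mem_rev.2 hp))) (hM.1.trans hM.2.symm)) with h1 | h1
  · exact hc1 h1
  · have h2 := h1 {a ∈ cross E R | φ (inner R a) ≠ c} fun a ha hac => mem_filter.2 ⟨ha, hac⟩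
    have h2z : (i : ℤ) ≤ #{a ∈ cross E R | φ (inner R a) ≠ c} := by exact_mod_cast h2
    have h4 := mul_le_mul_of_nonneg_left h2z (show (0 : ℤ) ≤ 2 * n by positivity)
    linarith

end ArcSet

namespace ArcSet

set_option linter.unusedSectionVars false

open Finset

variable {V : Type*} [DecidableEq V] {n : ℕ} {E : Finset (V × V)}

/-! ### Consequences of the potential bound -/

theorem sig_rev (E : Finset (V × V)) (v : V) : sig (rev E) v = (sig E v).swap := by
  simp [sig, outN_rev, inN_rev]

theorem twinCount_rev (E : Finset (V × V)) : twinCount (rev E) = twinCount E := by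
  simp only [twinCount, supp_rev, sig_rev, Prod.swap_inj]

theorem MinCounterexample.rev (h : MinCounterexample n E) : MinCounterexample n (rev E) where
  loopless := h.loopless.rev
  crit := h.crit.rev
  lt_wt := by rw [supp_rev, card_rev]; exact h.lt_wt
  wt_le F hl hF hs := by
    have := h.wt_le (ArcSet.rev F) hl.rev hF.rev
      (by simpa only [Smaller, supp_rev, card_rev, twinCount_rev] using hs)
    rwa [supp_rev, card_rev] at this

theorem Crit.two_le_card_supp [NeZero n] {W : Finset (V × V)} (h : Crit n W) (hl : Loopless W) :
    2 ≤ #(supp W) := by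
  obtain ⟨a, ha⟩ := h.exists_mem
  have : ({a.1, a.2} : Finset V) ⊆ supp W := by
    intro v hv
    rw [mem_insert, mem_singleton] at hv
    rcases hv with rfl | rfl
    exacts [fst_mem_supp ha, snd_mem_supp ha]
  have h1 := card_le_card this
  rwa [card_pair (hl a ha)] at h1

theorem MinCounterexample.isClique_of_wt_le (h : MinCounterexample n E) (hn : 4 ≤ n)
    {R : Finset V} (hR : R ⊂ supp E) (hR2 : 2 ≤ #R)
    (hw : wt n #R #(ind E R) ≤ n * (3 * n - 2)) : #R = n ∧ IsClique E R :=
  (h.lt_wt_ind hn hR hR2).resolve_left (not_lt.2 hw)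

theorem MinCounterexample.le_wt_ind (h : MinCounterexample n E) (hn : 4 ≤ n)
    {R : Finset V} (hR : R ⊂ supp E) (hR2 : 2 ≤ #R) :
    (n : ℤ) * (3 * n - 2) ≤ wt n #R #(ind E R) := by
  rcases h.lt_wt_ind hn hR hR2 with h1 | ⟨h1, h2⟩
  · exact h1.le
  · rw [wt, h2.card_ind h.loopless, h1]
    apply le_of_eq; ring

/-- A critical digraph on some but not all of the vertices has many more arcs than `E` has there. -/
theorem MinCounterexample.card_ind_add_le (h : MinCounterexample n E) (hn : 4 ≤ n)
    {W : Finset (V × V)} (hWl : Loopless W) (hW : Crit n W) (hs : supp W ⊂ supp E) :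
    #(ind E (supp W)) + n ≤ #W := by
  have hn0 : NeZero n := ⟨by omega⟩
  have h1 := h.le_wt_ind hn hs (hW.two_le_card_supp hWl)
  have h2 := h.wt_le W hWl hW (Or.inl (card_lt_card hs))
  by_contra! hlt
  have h3 : (#W : ℤ) + 1 ≤ #(ind E (supp W)) + n := by exact_mod_cast hlt
  have hnz : (4 : ℤ) ≤ n := by exact_mod_cast hn
  rw [wt] at h1 h2
  have h4 := mul_le_mul_of_nonneg_left h3 (show (0 : ℤ) ≤ 2 * n by positivity)
  nlinarith

/-- Up to `n - 1` arcs may be added to a proper part of a minimal counterexample. -/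
theorem MinCounterexample.col_ind_union (h : MinCounterexample n E) (hn : 4 ≤ n) {R : Finset V}
    (hR : R ⊂ supp E) {F : Finset (V × V)} (hFl : Loopless F) (hFR : supp F ⊆ R)
    (hF : #F < n) : Col n (ind E R ∪ F) := by
  by_contra hnot
  obtain ⟨W, hW, hWc⟩ := exists_crit hnot
  have hWl : Loopless W := ((h.loopless.mono (ind_subset _ _)).union hFl).mono hW
  have hWR : supp W ⊆ R := by
    rw [supp_subset_iff] at hFR ⊢
    intro a ha
    rcases mem_union.1 (hW ha) with h1 | h1
    exacts [(mem_ind.1 h1).2, hFR a h1]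
  have h1 := h.card_ind_add_le hn hWl hWc (hWR.trans_ssubset hR)
  have hs : W ⊆ ind E (supp W) ∪ F := fun a ha => by
    rcases mem_union.1 (hW ha) with h1 | h1
    · exact mem_union_left _ (mem_ind.2 ⟨(mem_ind.1 h1).1, fst_mem_supp ha, snd_mem_supp ha⟩)
    · exact mem_union_right _ h1
  have h3 := (card_le_card hs).trans (card_union_le _ _)
  omega

theorem IsClique.le_of_col {K : Finset V} (hK : IsClique E K) (h : Col n E) : #K ≤ n := by
  obtain ⟨φ, hφ⟩ := h
  have := card_le_card_of_injOn φ (fun _ _ => mem_univ _) (s := K) (t := univ) (by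
    intro u hu v hv huv
    by_contra hne
    exact hφ.ne_of_digon (hK u hu v hv hne) (hK v hv u hu (Ne.symm hne)) huv)
  simpa using this

theorem IsClique.mono {K L : Finset V} (hK : IsClique E K) (hL : L ⊆ K) : IsClique E L :=
  fun u hu v hv => hK u (hL hu) v (hL hv)

/-- A minimal counterexample has no clique of order `n + 1`. -/
theorem MinCounterexample.card_clique_le (h : MinCounterexample n E) (hn : 4 ≤ n) {K : Finset V}
    (hK : IsClique E K) : #K ≤ n := by
  by_contra! hlt
  obtain ⟨L, hLK, hL⟩ := exists_subset_card_eq (show n + 1 ≤ #K by omega)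
  have hLc := hK.mono hLK
  -- The clique is not colourable by itself, so by criticality it is all of `E`; but its potential
  -- equals the bound.
  have hE : ind E L = E := by
    by_contra hne
    have hcol := h.crit.col _ ((ind_subset E L).ssubset_of_ne hne)
    have : IsClique (ind E L) L := fun u hu v hv huv => mem_ind.2 ⟨hLc u hu v hv huv, hu, hv⟩
    have := this.le_of_col hcol
    omega
  have hs : supp E = L := by
    refine (supp_subset_iff.2 fun a ha => ?_).antisymm fun u hu => ?_
    · rw [← hE] at ha; exact (mem_ind.1 ha).2
    · obtain ⟨w, hw, hwu⟩ := exists_mem_ne (show 1 < #L by omega) u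
      exact mem_supp.2 ⟨w, Or.inl (hLc u hu w hw hwu.symm)⟩
  have h1 := hLc.card_ind h.loopless
  rw [hE, hL] at h1
  have h2 := h.lt_wt
  rw [wt, hs, hL, h1] at h2
  push_cast at h2
  nlinarith

/-! ### Low vertices and twins -/

/-- A vertex of least possible degree. -/
def IsLow (n : ℕ) (E : Finset (V × V)) (v : V) : Prop :=
  v ∈ supp E ∧ #(outN E v) = n ∧ #(inN E v) = n

instance (n : ℕ) (E : Finset (V × V)) : DecidablePred (IsLow n E) := fun _ =>
  inferInstanceAs (Decidable (_ ∧ _))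

/-- The vertices with the same closed neighbourhoods as `v`. -/
def Tw (E : Finset (V × V)) (v : V) : Finset V := {u ∈ supp E | sig E u = sig E v}

theorem mem_Tw {u v : V} : u ∈ Tw E v ↔ u ∈ supp E ∧ sig E u = sig E v := by simp [Tw]

theorem Tw_eq_of_mem {u v : V} (h : u ∈ Tw E v) : Tw E u = Tw E v := by
  ext w; rw [mem_Tw, mem_Tw, (mem_Tw.1 h).2]

theorem sig_eq_iff {u v : V} : sig E u = sig E v ↔
    insert u (outN E u) = insert v (outN E v) ∧ insert u (inN E u) = insert v (inN E v) := by
  simp [sig]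

theorem isLow_rev {v : V} : IsLow n (rev E) v ↔ IsLow n E v := by
  simp only [IsLow, supp_rev, outN_rev, inN_rev]; tauto

theorem Tw_rev (E : Finset (V × V)) (v : V) : Tw (rev E) v = Tw E v := by
  ext u; simp only [mem_Tw, supp_rev, sig_rev, Prod.swap_inj]

theorem notMem_outN (hl : Loopless E) (v : V) : v ∉ outN E v := fun h =>
  hl _ (mem_outN.1 h) rfl

theorem notMem_inN (hl : Loopless E) (v : V) : v ∉ inN E v := fun h =>
  hl _ (mem_inN.1 h) rfl

theorem IsLow.of_mem_Tw (hl : Loopless E) {u v : V} (hv : IsLow n E v) (hu : u ∈ Tw E v) :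
    IsLow n E u := by
  obtain ⟨hus, h⟩ := mem_Tw.1 hu
  obtain ⟨h1, h2⟩ := sig_eq_iff.1 h
  have h1 := congrArg card h1
  have h2 := congrArg card h2
  rw [card_insert_of_notMem (notMem_outN hl _), card_insert_of_notMem (notMem_outN hl _),
    hv.2.1] at h1
  rw [card_insert_of_notMem (notMem_inN hl _), card_insert_of_notMem (notMem_inN hl _),
    hv.2.2] at h2
  exact ⟨hus, by omega, by omega⟩

theorem mem_of_mem_Tw {u v : V} (hu : u ∈ Tw E v) (huv : u ≠ v) : (u, v) ∈ E ∧ (v, u) ∈ E := by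
  obtain ⟨h1, h2⟩ := sig_eq_iff.1 (mem_Tw.1 hu).2
  constructor
  · have : v ∈ insert u (outN E u) := h1 ▸ mem_insert_self _ _
    exact mem_outN.1 ((mem_insert.1 this).resolve_left huv.symm)
  · have : u ∈ insert v (outN E v) := h1 ▸ mem_insert_self _ _
    exact mem_outN.1 ((mem_insert.1 this).resolve_left huv)

theorem isClique_Tw (v : V) : IsClique E (Tw E v) := fun u hu w hw huw =>
  (mem_of_mem_Tw (show u ∈ Tw E w by rwa [Tw_eq_of_mem hw]) huw).1

theorem out_of_mem_Tw {u v w : V} (hu : u ∈ Tw E v) (h : (v, w) ∈ E) (hwu : w ≠ u) :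
    (u, w) ∈ E := by
  obtain ⟨h1, -⟩ := sig_eq_iff.1 (mem_Tw.1 hu).2
  have : w ∈ insert u (outN E u) := h1 ▸ mem_insert_of_mem (mem_outN.2 h)
  exact mem_outN.1 ((mem_insert.1 this).resolve_left hwu)

theorem in_of_mem_Tw {u v w : V} (hu : u ∈ Tw E v) (h : (w, v) ∈ E) (hwu : w ≠ u) :
    (w, u) ∈ E := by
  obtain ⟨-, h1⟩ := sig_eq_iff.1 (mem_Tw.1 hu).2
  have : w ∈ insert u (inN E u) := h1 ▸ mem_insert_of_mem (mem_inN.2 h)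
  exact mem_inN.1 ((mem_insert.1 this).resolve_left hwu)

theorem self_mem_Tw {v : V} (hv : v ∈ supp E) : v ∈ Tw E v := mem_Tw.2 ⟨hv, rfl⟩

/-- The low vertices of a clique of order `n` have a common neighbour outside, joined to them in
both directions, and no other neighbour outside. -/
theorem MinCounterexample.exists_apex (h : MinCounterexample n E) (hn : 4 ≤ n) {K : Finset V}
    (hK : IsClique E K) (hKn : #K = n) {x : V} (hxK : x ∈ K) (hx : IsLow n E x) :
    ∃ v, v ∉ K ∧ ∀ u ∈ K, IsLow n E u →
      outN E u = insert v (K.erase u) ∧ inN E u = insert v (K.erase u) := by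
  have hl := h.loopless
  have hout : ∀ u ∈ K, IsLow n E u → ∃ v, v ∉ K ∧ outN E u = insert v (K.erase u) := by
    intro u hu hul
    have hsub : K.erase u ⊆ outN E u := fun w hw => by
      rw [mem_erase] at hw
      exact mem_outN.2 (hK u hu w hw.2 hw.1.symm)
    have hc : #(outN E u \ K.erase u) = 1 := by
      have := card_sdiff_add_card_eq_card hsub
      rw [card_erase_of_mem hu, hul.2.1, hKn] at this
      omega
    obtain ⟨v, hv⟩ := card_eq_one.1 hc
    refine ⟨v, ?_, ?_⟩
    · have : v ∈ outN E u \ K.erase u := hv ▸ mem_singleton_self v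
      rw [mem_sdiff, mem_erase, not_and] at this
      refine this.2 ?_
      rintro rfl
      exact notMem_outN hl _ this.1
    · rw [insert_eq, ← hv, sdiff_union_of_subset hsub]
  have hin : ∀ u ∈ K, IsLow n E u → ∃ v, v ∉ K ∧ inN E u = insert v (K.erase u) := by
    intro u hu hul
    have hsub : K.erase u ⊆ inN E u := fun w hw => by
      rw [mem_erase] at hw
      exact mem_inN.2 (hK w hw.2 u hu hw.1)
    have hc : #(inN E u \ K.erase u) = 1 := by
      have := card_sdiff_add_card_eq_card hsub
      rw [card_erase_of_mem hu, hul.2.2, hKn] at this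
      omega
    obtain ⟨v, hv⟩ := card_eq_one.1 hc
    refine ⟨v, ?_, ?_⟩
    · have : v ∈ inN E u \ K.erase u := hv ▸ mem_singleton_self v
      rw [mem_sdiff, mem_erase, not_and] at this
      refine this.2 ?_
      rintro rfl
      exact notMem_inN hl _ this.1
    · rw [insert_eq, ← hv, sdiff_union_of_subset hsub]
  choose! p hpK hp using hout
  choose! q hqK hq using hin
  refine ⟨p x, hpK x hxK hx, ?_⟩
  by_contra! hcon
  obtain ⟨u₀, hu₀K, hu₀, hne⟩ := hcon
  obtain ⟨a, haK, has, hax, hau⟩ : ∃ a, a ∉ K ∧ a ∈ supp E ∧ a ≠ p x ∧ (a = p u₀ ∨ a = q u₀) := by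
    by_cases hpe : p u₀ = p x
    · have hqe : q u₀ ≠ p x := fun hqe =>
        hne (by rw [hp u₀ hu₀K hu₀, hpe]) (by rw [hq u₀ hu₀K hu₀, hqe])
      refine ⟨q u₀, hqK _ hu₀K hu₀, ?_, hqe, Or.inr rfl⟩
      have : q u₀ ∈ inN E u₀ := by rw [hq u₀ hu₀K hu₀]; exact mem_insert_self _ _
      exact mem_supp.2 ⟨_, Or.inl (mem_inN.1 this)⟩
    · refine ⟨p u₀, hpK _ hu₀K hu₀, ?_, hpe, Or.inl rfl⟩
      have : p u₀ ∈ outN E u₀ := by rw [hp u₀ hu₀K hu₀]; exact mem_insert_self _ _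
      exact mem_supp.2 ⟨_, Or.inr (mem_outN.1 this)⟩
  have hpxs : p x ∈ supp E := by
    have : p x ∈ outN E x := by rw [hp x hxK hx]; exact mem_insert_self _ _
    exact mem_supp.2 ⟨_, Or.inr (mem_outN.1 this)⟩
  set T := K.filter (IsLow n E) with hT
  have hTK : ∀ u ∈ T, u ∈ K ∧ IsLow n E u := fun u hu => mem_filter.1 hu
  have hxT : x ∈ T := mem_filter.2 ⟨hxK, hx⟩
  have hR : supp E \ T ⊂ supp E :=
    (sdiff_subset).ssubset_of_mem_notMem hx.1 fun hh => (mem_sdiff.1 hh).2 hxT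
  -- Two different outer neighbours are made to differ in colour by adding a digon, which costs 2 <
  -- n arcs.
  obtain ⟨φ, hφ⟩ := h.col_ind_union hn hR (F := {(a, p x), (p x, a)})
    (by
      intro e he
      rw [mem_insert, mem_singleton] at he
      rcases he with rfl | rfl
      exacts [hax, hax.symm])
    (by
      have h1 : a ∈ supp E \ T := mem_sdiff.2 ⟨has, fun hh => haK (hTK a hh).1⟩
      have h2 : p x ∈ supp E \ T := mem_sdiff.2 ⟨hpxs, fun hh => hpK x hxK hx (hTK _ hh).1⟩
      rw [supp_subset_iff]
      intro e he
      rw [mem_insert, mem_singleton] at he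
      rcases he with rfl | rfl
      exacts [⟨h1, h2⟩, ⟨h2, h1⟩])
    (lt_of_le_of_lt card_le_two (by omega))
  have hφa : φ a ≠ φ (p x) := hφ.ne_of_digon (mem_union_right _ (by simp))
    (mem_union_right _ (by simp))
  set C := univ \ (K \ T).image φ with hC
  have hTc : #T ≤ #C := by
    have h1 : #((K \ T).image φ) ≤ #(K \ T) := card_image_le
    have h2 := card_sdiff_add_card_eq_card (filter_subset (IsLow n E) K)
    have h3 := card_sdiff_add_card_eq_card (subset_univ ((K \ T).image φ))
    rw [card_univ, Fintype.card_fin] at h3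
    rw [← hT] at h2
    rw [← hC] at h3
    omega
  -- A low vertex is harmless unless both its outer neighbours have its colour, so each list omits
  -- at most one colour of `C`. Hall's condition could then fail only for all of `T`, where `φ a ≠ φ
  -- (p x)` ensures that every colour of `C` is in some list.
  let Lst : T → Finset (Fin n) := fun u => C.filter fun c => ¬ (φ (p u) = c ∧ φ (q u) = c)
  obtain ⟨β, hβinj, hβ⟩ := (all_card_le_biUnion_card_iff_exists_injective Lst).1 (by
    intro S
    rcases S.eq_empty_or_nonempty with rfl | ⟨u, hu⟩
    · simp
    have hLu : #C ≤ #(Lst u) + 1 := by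
      have : C ⊆ insert (φ (p u)) (Lst u) := fun c hc => by
        by_cases he : φ (p u) = c
        · exact mem_insert.2 (Or.inl he.symm)
        · exact mem_insert_of_mem (mem_filter.2 ⟨hc, fun hh => he hh.1⟩)
      exact (card_le_card this).trans (card_insert_le _ _)
    by_cases hS : #S < #T
    · have := card_le_card (subset_biUnion_of_mem Lst hu)
      omega
    · have hSu : S = univ := by
        rw [← card_eq_iff_eq_univ]
        have := card_le_univ S
        rw [Fintype.card_coe] at this ⊢
        omega
      have hsub : C ⊆ S.biUnion Lst := fun c hc => by
        rw [mem_biUnion]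
        by_contra! hall
        have hall' : ∀ w : T, φ (p w) = c ∧ φ (q w) = c := by
          intro w
          by_contra hnot
          exact hall w (hSu ▸ mem_univ w) (mem_filter.2 ⟨hc, hnot⟩)
        have h1 := hall' ⟨x, hxT⟩
        have h2 := hall' ⟨u₀, mem_filter.2 ⟨hu₀K, hu₀⟩⟩
        refine hφa ?_
        rcases hau with rfl | rfl
        · exact h2.1.trans h1.1.symm
        · exact h2.2.trans h1.1.symm
      have := card_le_card hsub
      have hSc := card_le_univ S
      rw [Fintype.card_coe] at hSc
      omega)
  have hβC : ∀ u : T, β u ∈ C ∧ ¬ (φ (p u) = β u ∧ φ (q u) = β u) := fun u =>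
    mem_filter.1 (hβ u)
  let χ : V → Fin n := fun u => if hu : u ∈ T then β ⟨u, hu⟩ else φ u
  have hχT : ∀ u (hu : u ∈ T), χ u = β ⟨u, hu⟩ := fun u hu => dif_pos hu
  have hχn : ∀ u, u ∉ T → χ u = φ u := fun u hu => dif_neg hu
  have hχK : ∀ u (hu : u ∈ T), ∀ w ∈ K, w ≠ u → χ w ≠ β ⟨u, hu⟩ := by
    intro u hu w hw hwu he
    by_cases hwT : w ∈ T
    · rw [hχT w hwT] at he
      exact hwu (congrArg Subtype.val (hβinj he))
    · rw [hχn w hwT] at he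
      have := (hβC ⟨u, hu⟩).1
      rw [hC, mem_sdiff] at this
      exact this.2 (he ▸ mem_image_of_mem _ (mem_sdiff.2 ⟨hw, hwT⟩))
  refine h.crit.not_col ⟨χ, Proper.of_del (S := T) ?_ ?_⟩
  · refine (hφ.mono (subset_union_left (s₂ := _))).congr ?_ |>.mono (F := del E T) ?_
    · intro e he
      have h1 := mem_ind.1 he
      exact ⟨hχn _ (mem_sdiff.1 h1.2.1).2, hχn _ (mem_sdiff.1 h1.2.2).2⟩
    · intro e he
      have h1 := mem_del.1 he
      exact mem_ind.2 ⟨h1.1, mem_sdiff.2 ⟨fst_mem_supp h1.1, h1.2.1⟩,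
        mem_sdiff.2 ⟨snd_mem_supp h1.1, h1.2.2⟩⟩
  · intro u hu
    obtain ⟨huK, hul⟩ := hTK u hu
    rw [hχT u hu]
    by_cases hpu : φ (p u) = β ⟨u, hu⟩
    · right
      intro w hw
      have : w ∈ insert (q u) (K.erase u) := hq u huK hul ▸ mem_inN.2 hw
      rw [mem_insert, mem_erase] at this
      rcases this with rfl | hw'
      · rw [hχn _ fun hh => hqK u huK hul (hTK _ hh).1]
        exact fun hh => (hβC ⟨u, hu⟩).2 ⟨hpu, hh⟩
      · exact hχK u hu w hw'.2 hw'.1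
    · left
      intro w hw
      have : w ∈ insert (p u) (K.erase u) := hp u huK hul ▸ mem_outN.2 hw
      rw [mem_insert, mem_erase] at this
      rcases this with rfl | hw'
      · rwa [hχn _ fun hh => hpK u huK hul (hTK _ hh).1]
      · exact hχK u hu w hw'.2 hw'.1

/-! ### Replacing a vertex -/

theorem card_eq_del_add (hl : Loopless E) (v : V) :
    #E = #(del E {v}) + #(outN E v) + #(inN E v) := by
  rw [← card_filter_fst, ← card_filter_snd, ← card_union_of_disjoint, ← card_union_of_disjoint]
  · congr 1
    ext a
    simp only [mem_union, mem_del, mem_singleton, mem_filter]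
    tauto
  · refine disjoint_left.2 fun a ha ha' => ?_
    rw [mem_filter] at ha'
    rcases mem_union.1 ha with h1 | h1
    · simp only [mem_del, mem_singleton] at h1; exact h1.2.2 ha'.2
    · rw [mem_filter] at h1; exact hl a h1.1 (h1.2.trans ha'.2.symm)
  · refine disjoint_left.2 fun a ha ha' => ?_
    rw [mem_filter] at ha'
    simp only [mem_del, mem_singleton] at ha
    exact ha.2.1 ha'.2

/-- `E` with `v` replaced by a vertex with out-neighbourhood `O` and in-neighbourhood `I`. -/
def replace (E : Finset (V × V)) (v : V) (O I : Finset V) : Finset (V × V) :=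
  del E {v} ∪ (O.image (fun w => (v, w)) ∪ I.image (fun w => (w, v)))

theorem mem_replace {v : V} {O I : Finset V} {a b : V} :
    (a, b) ∈ replace E v O I ↔
      ((a, b) ∈ E ∧ a ≠ v ∧ b ≠ v) ∨ (a = v ∧ b ∈ O) ∨ (b = v ∧ a ∈ I) := by
  simp only [replace, mem_union, mem_del, mem_singleton, mem_image, Prod.mk.injEq]
  constructor
  · rintro (h | ⟨w, hw, rfl, rfl⟩ | ⟨w, hw, rfl, rfl⟩)
    exacts [Or.inl h, Or.inr (Or.inl ⟨rfl, hw⟩), Or.inr (Or.inr ⟨rfl, hw⟩)]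
  · rintro (h | ⟨rfl, hw⟩ | ⟨rfl, hw⟩)
    exacts [Or.inl h, Or.inr (Or.inl ⟨_, hw, rfl, rfl⟩), Or.inr (Or.inr ⟨_, hw, rfl, rfl⟩)]

theorem del_subset_replace (v : V) (O I : Finset V) : del E {v} ⊆ replace E v O I :=
  subset_union_left

/-- A critical `W` in the new digraph contains `v`, with exactly the prescribed neighbourhoods since
`n` is the least possible degree. If `W` spans all vertices, the choice of the counterexample leaves
only a tie in arcs without a gain in twins. Otherwise, removing `v` and its 2n arcs from `W` leaves
a set of potential at most n(3n - 2), hence a clique of order `n`. -/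
theorem MinCounterexample.of_replace (h : MinCounterexample n E) (hn : 4 ≤ n) {v : V}
    (hv : v ∈ supp E) {O I : Finset V} (hO : O ⊆ (supp E).erase v) (hI : I ⊆ (supp E).erase v)
    (hOn : #O = n) (hIn : #I = n) (hnc : ¬ Col n (replace E v O I)) :
    (IsClique E O ∧ I = O) ∨ (#(outN E v) + #(inN E v) ≤ 2 * n ∧
      supp (replace E v O I) = supp E ∧ twinCount (replace E v O I) ≤ twinCount E) := by
  have hl := h.loopless
  have hvO : v ∉ O := fun hh => notMem_erase _ _ (hO hh)
  have hvI : v ∉ I := fun hh => notMem_erase _ _ (hI hh)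
  obtain ⟨W, hW, hWc⟩ := exists_crit hnc
  have hrl : Loopless (replace E v O I) := by
    rintro ⟨a, b⟩ hab hh
    simp only at hh
    subst hh
    rw [mem_replace] at hab
    rcases hab with h1 | ⟨rfl, h1⟩ | ⟨rfl, h1⟩
    exacts [hl _ h1.1 rfl, hvO h1, hvI h1]
  have hWl := hrl.mono hW
  have hvW : v ∈ supp W := by
    by_contra hvW
    refine hWc.not_col ((h.crit.col_del hv).mono fun ⟨a, b⟩ ha => ?_)
    have h1 := fst_mem_supp ha
    have h2 := snd_mem_supp ha
    rcases mem_replace.1 (hW ha) with h3 | ⟨rfl, h3⟩ | ⟨rfl, h3⟩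
    · simpa using h3
    · exact absurd h1 hvW
    · exact absurd h2 hvW
  have hWO : outN W v = O := by
    refine eq_of_subset_of_card_le (fun w hw => ?_) (hOn ▸ hWc.le_outN hWl hvW)
    have := mem_replace.1 (hW (mem_outN.1 hw))
    have hne := hWl _ (mem_outN.1 hw)
    simp only at hne
    tauto
  have hWI : inN W v = I := by
    refine eq_of_subset_of_card_le (fun w hw => ?_) (hIn ▸ hWc.le_inN hWl hvW)
    have := mem_replace.1 (hW (mem_inN.1 hw))
    have hne := hWl _ (mem_inN.1 hw)
    simp only at hne
    tauto
  have hs : supp (replace E v O I) ⊆ supp E := by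
    rw [supp_subset_iff]
    rintro ⟨a, b⟩ hab
    rcases mem_replace.1 hab with h3 | ⟨rfl, h3⟩ | ⟨rfl, h3⟩
    · exact ⟨fst_mem_supp h3.1, snd_mem_supp h3.1⟩
    · exact ⟨hv, mem_of_mem_erase (hO h3)⟩
    · exact ⟨mem_of_mem_erase (hI h3), hv⟩
  have hsW := (supp_mono hW).trans hs
  have hWcard := card_eq_del_add hWl v
  rw [hWO, hWI, hOn, hIn] at hWcard
  have hEcard := card_eq_del_add hl v
  have hdW : del W {v} ⊆ ind E ((supp W).erase v) := fun ⟨a, b⟩ ha => by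
    simp only [mem_del, mem_singleton] at ha
    have h1 := mem_replace.1 (hW ha.1)
    rw [mem_ind, mem_erase, mem_erase]
    have h2 := fst_mem_supp ha.1
    have h3 := snd_mem_supp ha.1
    tauto
  have hdWc := card_le_card hdW
  have hout := h.crit.le_outN hl hv
  have hin := h.crit.le_inN hl hv
  have hnz : (4 : ℤ) ≤ n := by exact_mod_cast hn
  by_cases hWs : supp W = supp E
  · right
    have hdWE : #(del W {v}) ≤ #(del E {v}) := by
      refine card_le_card fun ⟨a, b⟩ ha => ?_
      simp only [mem_del, mem_singleton] at ha
      have h1 := mem_replace.1 (hW ha.1)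
      rw [mem_del, mem_singleton, mem_singleton]
      tauto
    have hnot : ¬ Smaller W E := fun hsm => by
      have h1 := h.wt_le W hWl hWc hsm
      have h2 := h.lt_wt
      have h3 : #W ≤ #E := by omega
      have h4 := mul_le_mul_of_nonneg_left (show (#W : ℤ) ≤ #E by exact_mod_cast h3)
        (show (0 : ℤ) ≤ 2 * n by positivity)
      rw [wt, hWs] at h1
      rw [wt] at h2
      linarith
    have hWE : #E ≤ #W := by
      by_contra! hlt
      exact hnot (Or.inr ⟨congrArg card hWs, Or.inl hlt⟩)
    have hWeq : W = replace E v O I := by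
      refine eq_of_subset_of_card_le hW ?_
      have h1 : #(replace E v O I) ≤ #(del E {v}) + (n + n) := by
        refine (card_union_le _ _).trans ?_
        have h2 := card_union_le (O.image (fun w => (v, w))) (I.image (fun w => (w, v)))
        have h3 : #(O.image (fun w => (v, w))) ≤ #O := card_image_le
        have h4 : #(I.image (fun w => (w, v))) ≤ #I := card_image_le
        omega
      omega
    refine ⟨by omega, hWeq ▸ hWs, ?_⟩
    by_contra! hlt
    exact hnot (Or.inr ⟨congrArg card hWs, Or.inr ⟨by omega, hWeq ▸ hlt⟩⟩)
  · left
    have hss := hsW.ssubset_of_ne hWs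
    have hP := h.wt_le W hWl hWc (Or.inl (card_lt_card hss))
    have hOs : O ⊆ (supp W).erase v := fun w hw => by
      refine mem_erase.2 ⟨fun hh => hvO (hh ▸ hw), ?_⟩
      rw [← hWO, mem_outN] at hw
      exact snd_mem_supp hw
    have hIs : I ⊆ (supp W).erase v := fun w hw => by
      refine mem_erase.2 ⟨fun hh => hvI (hh ▸ hw), ?_⟩
      rw [← hWI, mem_inN] at hw
      exact fst_mem_supp hw
    have hQ : (supp W).erase v ⊂ supp E := ((erase_subset _ _).trans hsW).ssubset_of_mem_notMem
      hv (notMem_erase _ _)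
    have hQc : (#((supp W).erase v) : ℤ) = #(supp W) - 1 := by
      rw [card_erase_of_mem hvW, Nat.cast_sub (card_pos.2 ⟨v, hvW⟩)]; simp
    obtain ⟨h1, h2⟩ := h.isClique_of_wt_le hn hQ (by have := card_le_card hOs; omega) (by
      rw [wt] at hP ⊢
      rw [hQc]
      have h3 : (#W : ℤ) ≤ #(ind E ((supp W).erase v)) + 2 * n := by
        have : #W ≤ #(ind E ((supp W).erase v)) + 2 * n := by omega
        exact_mod_cast this
      have h4 := mul_le_mul_of_nonneg_left h3 (show (0 : ℤ) ≤ 2 * n by positivity)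
      nlinarith)
    have hOe := eq_of_subset_of_card_le hOs (by omega)
    have hIe := eq_of_subset_of_card_le hIs (by omega)
    exact ⟨hOe ▸ h2, hIe.trans hOe.symm⟩

/-- A colouring without `v` extends to `v` if the clique `T` can be recoloured by one extra colour
and `v` has few neighbours outside `T`. -/
theorem col_of_recolor (hl : Loopless E) {v : V} {T : Finset V}
    (hdeg : #(inN E v \ T) < n ∨ #(outN E v \ T) < n) {ψ : V → Fin n}
    (hψ : Proper (del E {v}) ψ) (hT : ∀ t ∈ T, ψ t ≠ ψ v) (hinj : Set.InjOn ψ T)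
    (hre : ∀ t ∈ T, Proper (del E {v}) (Function.update ψ t (ψ v))) : Col n E := by
  have main : ∀ S : Finset V, v ∉ S → #(S \ T) < n → ∃ φ : V → Fin n, ∃ c : Fin n,
      Proper (del E {v}) φ ∧ ∀ w ∈ S, φ w ≠ c := by
    intro S hvS hS
    obtain ⟨c, hc⟩ := exists_color_notMem ψ hS
    -- The colour `c` can occur in `S` only at a single vertex of `T`; giving that vertex the colour
    -- `ψ v` frees `c` for `v`.
    by_cases ht : ∃ t ∈ T, ψ t = c
    · obtain ⟨t, htT, htc⟩ := ht
      refine ⟨_, c, hre t htT, fun w hw => ?_⟩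
      by_cases hwt : w = t
      · subst hwt
        rw [Function.update_self, ← htc]
        exact (hT w htT).symm
      · rw [Function.update_of_ne hwt]
        by_cases hwT : w ∈ T
        · rw [← htc]; exact fun hh => hwt (hinj hwT htT hh)
        · exact hc w (mem_sdiff.2 ⟨hw, hwT⟩)
    · push Not at ht
      refine ⟨ψ, c, hψ, fun w hw => ?_⟩
      by_cases hwT : w ∈ T
      · exact ht w hwT
      · exact hc w (mem_sdiff.2 ⟨hw, hwT⟩)
  rcases hdeg with hdeg | hdeg
  · obtain ⟨φ, c, hφ, hc⟩ := main _ (notMem_inN hl v) hdeg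
    refine ⟨Function.update φ v c, (hφ.update c).of_del_in fun w hw => ?_⟩
    rw [Function.update_of_ne (hl _ hw), Function.update_self]
    exact hc w (mem_inN.2 hw)
  · obtain ⟨φ, c, hφ, hc⟩ := main _ (notMem_outN hl v) hdeg
    exact col_of_del_out hl hφ hc

theorem insert_erase_subset_supp {x v : V} {S : Finset V} (hx : x ∈ supp E) (hxv : x ≠ v)
    (hS : S ⊆ supp E) : insert x (S.erase v) ⊆ (supp E).erase v := by
  intro w hw
  rw [mem_insert, mem_erase] at hw
  rcases hw with rfl | hw
  exacts [mem_erase.2 ⟨hxv, hx⟩, mem_erase.2 ⟨hw.1, hS hw.2⟩]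

theorem outN_subset_supp (v : V) : outN E v ⊆ supp E := fun _ hw => snd_mem_supp (mem_outN.1 hw)

theorem inN_subset_supp (v : V) : inN E v ⊆ supp E := fun _ hw => fst_mem_supp (mem_inN.1 hw)

theorem card_insert_erase {S : Finset V} {x v : V} (hx : x ∉ S) (hv : v ∈ S) :
    #(insert x (S.erase v)) = #S := by
  rw [card_insert_of_notMem fun h => hx (mem_of_mem_erase h), card_erase_of_mem hv]
  have := card_pos.2 ⟨v, hv⟩
  omega

/-- A non-low out-neighbour of a low vertex `x` has large degrees. -/
theorem MinCounterexample.isClique_of_few (h : MinCounterexample n E) (hn : 4 ≤ n) {x v : V}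
    (hx : IsLow n E x) (hxv : (x, v) ∈ E) (hv : 2 * n < #(outN E v) + #(inN E v))
    (hdeg : #(inN E v \ Tw E x) < n ∨ #(outN E v \ Tw E x) < n) :
    IsClique E (insert x ((outN E x).erase v)) := by
  have hl := h.loopless
  have hvs : v ∈ supp E := snd_mem_supp hxv
  set O := insert x ((outN E x).erase v) with hO
  have hOs : O ⊆ (supp E).erase v := insert_erase_subset_supp hx.1 (hl _ hxv) (outN_subset_supp x)
  have hOn : #O = n := by
    rw [hO, card_insert_erase (notMem_outN hl x) (mem_outN.2 hxv), hx.2.1]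
  have hvT : v ∉ Tw E x := fun hh => by
    have := hx.of_mem_Tw hl hh
    have h1 := this.2.1
    have h2 := this.2.2
    omega
  have hTO : ∀ t ∈ Tw E x, ∀ w ∈ insert t (outN E t), w ≠ v → w ∈ O := fun t ht w hw hwv => by
    rw [(sig_eq_iff.1 (mem_Tw.1 ht).2).1, mem_insert] at hw
    rw [hO, mem_insert, mem_erase]
    tauto
  have hnc : ¬ Col n (replace E v O O) := by
    rintro ⟨ψ, hψ⟩
    have hψ' := hψ.mono (del_subset_replace v O O)
    -- Since `O` contains the twins of `x` and their out-neighbours other than `v`, any one twin can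
    -- take the colour `ψ v`.
    have hψO : ∀ w ∈ O, ψ w ≠ ψ v := fun w hw => hψ.ne_of_digon
      (mem_replace.2 (Or.inr (Or.inr ⟨rfl, hw⟩))) (mem_replace.2 (Or.inr (Or.inl ⟨rfl, hw⟩)))
    have hTv : ∀ t ∈ Tw E x, t ≠ v := fun t ht hh => hvT (hh ▸ ht)
    refine h.crit.not_col (col_of_recolor hl hdeg hψ'
      (fun t ht => hψO t (hTO t ht t (mem_insert_self _ _) (hTv t ht))) ?_ ?_)
    · intro t ht u hu htu
      by_contra hne
      refine hψ'.ne_of_digon (u := t) (v := u) ?_ ?_ htu <;>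
        simp only [mem_del, mem_singleton]
      · exact ⟨isClique_Tw x t ht u hu hne, hTv t ht, hTv u hu⟩
      · exact ⟨isClique_Tw x u hu t ht (Ne.symm hne), hTv u hu, hTv t ht⟩
    · intro t ht
      refine Proper.of_del_out (v := t) ((hψ'.mono (del_subset _ _)).update _) fun w hw => ?_
      simp only [mem_del, mem_singleton] at hw
      rw [Function.update_self, Function.update_of_ne (hl _ hw.1).symm]
      exact hψO w (hTO t ht w (mem_insert_of_mem (mem_outN.2 hw.1)) hw.2.2)
  rcases h.of_replace hn hvs hOs hOs hOn hOn hnc with h1 | h1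
  · exact h1.1
  · omega

theorem card_twinPairs_aux {D : Finset (V × V)} (v : V) :
    #D = #{p ∈ D | p.1 ≠ v ∧ p.2 ≠ v} + #{p ∈ D | ¬ (p.1 ≠ v ∧ p.2 ≠ v)} :=
  (card_filter_add_card_filter_not _).symm

/-- After the replacement, other vertices see `v` precisely when they saw `x` (or are `x`). Hence
twins other than `v` stay twins. -/
theorem mem_closedOut_replace {x v u z : V} {O I : Finset V} (hu : u ≠ v)
    (hI : ∀ u, u ≠ v → (u ∈ I ↔ x ∈ insert u (outN E u))) :
    z ∈ insert u (outN (replace E v O I) u) ↔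
      if z = v then x ∈ insert u (outN E u) else z ∈ insert u (outN E u) := by
  by_cases hz : z = v
  · subst hz
    rw [if_pos rfl, ← hI u hu]
    simp [mem_replace, hu, hu.symm]
  · simp [mem_replace, hu, hz]

theorem mem_closedIn_replace {x v u z : V} {O I : Finset V} (hu : u ≠ v)
    (hO : ∀ u, u ≠ v → (u ∈ O ↔ x ∈ insert u (inN E u))) :
    z ∈ insert u (inN (replace E v O I) u) ↔
      if z = v then x ∈ insert u (inN E u) else z ∈ insert u (inN E u) := by
  by_cases hz : z = v
  · subst hz
    rw [if_pos rfl, ← hO u hu]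
    simp [mem_replace, hu, hu.symm]
  · simp [mem_replace, hu, hz]

/-- Of two adjacent low vertices that are not twins, the one with at least as many twins lies in a
clique of order `n` avoiding the other. -/
theorem MinCounterexample.isClique_of_twins (h : MinCounterexample n E) (hn : 4 ≤ n) {x v : V}
    (hx : IsLow n E x) (hv : IsLow n E v) (hxv : (x, v) ∈ E) (hvx : (v, x) ∈ E)
    (hvT : v ∉ Tw E x) (hle : #(Tw E v) ≤ #(Tw E x)) :
    IsClique E (insert x ((outN E x).erase v)) := by
  have hl := h.loopless
  have hne : x ≠ v := hl _ hxv
  set O := insert x ((outN E x).erase v) with hO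
  set I := insert x ((inN E x).erase v) with hI
  have hOs : O ⊆ (supp E).erase v := insert_erase_subset_supp hx.1 hne (outN_subset_supp x)
  have hIs : I ⊆ (supp E).erase v := insert_erase_subset_supp hx.1 hne (inN_subset_supp x)
  have hOn : #O = n := by
    rw [hO, card_insert_erase (notMem_outN hl x) (mem_outN.2 hxv), hx.2.1]
  have hIn : #I = n := by
    rw [hI, card_insert_erase (notMem_inN hl x) (mem_inN.2 hvx), hx.2.2]
  have hTO : ∀ t ∈ Tw E x, ∀ w ∈ insert t (outN E t), w ≠ v → w ∈ O := fun t ht w hw hwv => by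
    rw [(sig_eq_iff.1 (mem_Tw.1 ht).2).1, mem_insert] at hw
    rw [hO, mem_insert, mem_erase]
    tauto
  have hTI : ∀ t ∈ Tw E x, ∀ w ∈ insert t (inN E t), w ≠ v → w ∈ I := fun t ht w hw hwv => by
    rw [(sig_eq_iff.1 (mem_Tw.1 ht).2).2, mem_insert] at hw
    rw [hI, mem_insert, mem_erase]
    tauto
  have hTv : ∀ t ∈ Tw E x, t ≠ v := fun t ht hh => hvT (hh ▸ ht)
  have hnc : ¬ Col n (replace E v O I) := by
    rintro ⟨ψ, hψ⟩
    have hψ' := hψ.mono (del_subset_replace v O I)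
    -- Of the `n` in-neighbours of `v`, at least `x` itself is discounted.
    have hdeg : #(inN E v \ Tw E x) < n := by
      rw [← hv.2.2]
      refine card_lt_card (sdiff_subset.ssubset_of_mem_notMem (mem_inN.2 hxv) fun hh => ?_)
      exact (mem_sdiff.1 hh).2 (self_mem_Tw hx.1)
    refine h.crit.not_col (col_of_recolor hl (Or.inl hdeg) hψ' ?_ ?_ ?_)
    · intro t ht
      exact hψ.ne_of_digon
        (mem_replace.2 (Or.inr (Or.inr ⟨rfl, hTI t ht t (mem_insert_self _ _) (hTv t ht)⟩)))
        (mem_replace.2 (Or.inr (Or.inl ⟨rfl, hTO t ht t (mem_insert_self _ _) (hTv t ht)⟩)))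
    · intro t ht u hu htu
      by_contra hne
      refine hψ'.ne_of_digon (u := t) (v := u) ?_ ?_ htu <;>
        simp only [mem_del, mem_singleton]
      · exact ⟨isClique_Tw x t ht u hu hne, hTv t ht, hTv u hu⟩
      · exact ⟨isClique_Tw x u hu t ht (Ne.symm hne), hTv u hu, hTv t ht⟩
    · intro t ht
      -- Recolouring `t` is pulling `ψ` back along `t ↦ v`, a digraph map because the new `v` has
      -- all neighbours of `t`.
      have hcomp : Function.update ψ t (ψ v) = fun u => ψ (if u = t then v else u) := by
        funext u
        by_cases hu : u = t
        · subst hu; simp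
        · simp [hu]
      rw [hcomp]
      refine hψ.comap _ fun ⟨a, b⟩ hab => ?_
      simp only [mem_del, mem_singleton] at hab
      have hloop := hl _ hab.1
      simp only at hloop ⊢
      rw [mem_replace]
      by_cases ha : a = t
      · subst ha
        rw [if_pos rfl, if_neg hloop.symm]
        exact Or.inr (Or.inl ⟨rfl, hTO _ ht _ (mem_insert_of_mem (mem_outN.2 hab.1)) hab.2.2⟩)
      · rw [if_neg ha]
        by_cases hb : b = t
        · subst hb
          rw [if_pos rfl]
          exact Or.inr (Or.inr ⟨rfl, hTI _ ht _ (mem_insert_of_mem (mem_inN.2 hab.1)) hab.2.1⟩)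
        · rw [if_neg hb]; exact Or.inl hab
  rcases h.of_replace hn hv.1 hOs hIs hOn hIn hnc with h1 | ⟨-, hsupp, h1⟩
  · exact h1.1
  · exfalso
    set F := replace E v O I with hF
    have hOiff : ∀ u, u ≠ v → (u ∈ O ↔ x ∈ insert u (inN E u)) := fun u hu => by
      rw [hO, mem_insert, mem_insert, mem_erase, mem_outN, mem_inN, eq_comm]
      simp [hu]
    have hIiff : ∀ u, u ≠ v → (u ∈ I ↔ x ∈ insert u (outN E u)) := fun u hu => by
      rw [hI, mem_insert, mem_insert, mem_erase, mem_outN, mem_inN, eq_comm]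
      simp [hu]
    have hcl : ∀ u w, u ≠ v → w ≠ v → sig E u = sig E w → sig F u = sig F w := by
      intro u w huv hwv huw
      obtain ⟨h2, h3⟩ := sig_eq_iff.1 huw
      rw [sig_eq_iff]
      constructor
      · ext z
        rw [hF, mem_closedOut_replace huv hIiff, mem_closedOut_replace hwv hIiff, h2]
      · ext z
        rw [hF, mem_closedIn_replace huv hOiff, mem_closedIn_replace hwv hOiff, h3]
    have hxvF : sig F v = sig F x := by
      rw [sig_eq_iff]
      constructor
      · ext z
        rw [hF, mem_closedOut_replace hne hIiff]
        by_cases hz : z = v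
        · simp [hz]
        · simp [mem_replace, hO, hz]
      · ext z
        rw [hF, mem_closedIn_replace hne hOiff]
        by_cases hz : z = v
        · simp [hz]
        · simp [mem_replace, hI, hz]
    -- Pairs without `v` survive. At `v`, at most 2|Tw v| - 1 pairs are lost and at least 2|Tw x| +
    -- 1 are gained, so the number of twin pairs would grow.
    rw [twinCount, twinCount, card_twinPairs_aux v, hsupp,
      card_twinPairs_aux (D := {p ∈ supp E ×ˢ supp E | sig E p.1 = sig E p.2}) v] at h1
    have hA : #{p ∈ {p ∈ supp E ×ˢ supp E | sig E p.1 = sig E p.2} | p.1 ≠ v ∧ p.2 ≠ v} ≤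
        #{p ∈ {p ∈ supp E ×ˢ supp E | sig F p.1 = sig F p.2} | p.1 ≠ v ∧ p.2 ≠ v} := by
      refine card_le_card fun p hp => ?_
      simp only [mem_filter] at hp ⊢
      exact ⟨⟨hp.1.1, hcl _ _ hp.2.1 hp.2.2 hp.1.2⟩, hp.2⟩
    have hB : #{p ∈ {p ∈ supp E ×ˢ supp E | sig E p.1 = sig E p.2} | ¬ (p.1 ≠ v ∧ p.2 ≠ v)} ≤
        #(Tw E v) + (#(Tw E v) - 1) := by
      rw [← card_erase_of_mem (self_mem_Tw hv.1)]
      refine le_trans (card_le_card (t := (Tw E v).image (fun w => (v, w)) ∪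
        ((Tw E v).erase v).image (fun w => (w, v))) fun ⟨a, b⟩ hp => ?_)
        ((card_union_le _ _).trans (add_le_add card_image_le card_image_le))
      simp only [mem_filter, mem_product] at hp
      by_cases ha : a = v
      · subst ha
        exact mem_union_left _ (mem_image_of_mem _ (mem_Tw.2 ⟨hp.1.1.2, hp.1.2.symm⟩))
      · have hb : b = v := by tauto
        subst hb
        exact mem_union_right _ (mem_image.2
          ⟨a, mem_erase.2 ⟨ha, mem_Tw.2 ⟨hp.1.1.1, hp.1.2⟩⟩, rfl⟩)
    have hC : #(insert v (Tw E x)) + #(Tw E x) ≤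
        #{p ∈ {p ∈ supp E ×ˢ supp E | sig F p.1 = sig F p.2} | ¬ (p.1 ≠ v ∧ p.2 ≠ v)} := by
      have i1 : Function.Injective (fun w : V => (v, w)) := fun a b hab => (Prod.ext_iff.1 hab).2
      have i2 : Function.Injective (fun w : V => (w, v)) := fun a b hab => (Prod.ext_iff.1 hab).1
      rw [← card_image_of_injective (insert v (Tw E x)) i1,
        ← card_image_of_injective (Tw E x) i2, ← card_union_of_disjoint]
      · refine card_le_card fun p hp => ?_
        have hT : ∀ w ∈ Tw E x, w ∈ supp E ∧ sig F w = sig F v := fun w hw =>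
          ⟨(mem_Tw.1 hw).1, (hcl w x (hTv w hw) hne (mem_Tw.1 hw).2).trans hxvF.symm⟩
        rw [mem_union, mem_image, mem_image] at hp
        simp only [mem_filter, mem_product]
        rcases hp with ⟨w, hw, rfl⟩ | ⟨w, hw, rfl⟩
        · rw [mem_insert] at hw
          rcases hw with rfl | hw
          · exact ⟨⟨⟨hv.1, hv.1⟩, rfl⟩, by simp⟩
          · exact ⟨⟨⟨hv.1, (hT w hw).1⟩, (hT w hw).2.symm⟩, by simp⟩
        · exact ⟨⟨⟨(hT w hw).1, hv.1⟩, (hT w hw).2⟩, by simp⟩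
      · refine disjoint_left.2 fun p hp hp' => ?_
        obtain ⟨w, -, rfl⟩ := mem_image.1 hp
        obtain ⟨u, hu, he⟩ := mem_image.1 hp'
        have h2 : u = v := (Prod.ext_iff.1 he).1
        exact hvT (h2 ▸ hu)
    rw [card_insert_of_notMem hvT] at hC
    omega

/-! ### Arcs that are not part of a digon -/

/-- Delete `x` and replace the in-arcs of `y` by the reverses of its out-arcs. A colouring would
extend to `E` with `x` coloured like `y`, because the out-neighbours of `x` are all coloured
differently. So there is a critical `W`, of degree 2n at `y`. Removing `y` from `W` gives potential
at most n(3n - 2), hence the clique. As `W` has at least n arcs more than `E` has on its vertices,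
no arc of `E` goes from the clique back to `y`. -/
theorem MinCounterexample.isClique_outN (h : MinCounterexample n E) (hn : 4 ≤ n) {x y : V}
    (hx : IsLow n E x) (hxy : (x, y) ∈ E) (hyx : (y, x) ∉ E) (hy : #(outN E y) = n) :
    IsClique E (outN E y) ∧ ∀ z, (y, z) ∈ E → (z, y) ∉ E := by
  have hl := h.loopless
  have hxney : x ≠ y := hl _ hxy
  have hys : y ∈ supp E := snd_mem_supp hxy
  set F : Finset (V × V) := {a ∈ del E {x} | a.2 ≠ y} ∪ (outN E y).image (fun z => (z, y))
    with hF
  have memF : ∀ {a b}, (a, b) ∈ F ↔ ((a, b) ∈ E ∧ a ≠ x ∧ b ≠ x ∧ b ≠ y) ∨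
      (b = y ∧ (y, a) ∈ E) := by
    intro a b
    simp only [hF, mem_union, mem_filter, mem_del, mem_singleton, mem_image, mem_outN,
      Prod.mk.injEq]
    constructor
    · rintro (h1 | ⟨z, hz, rfl, rfl⟩)
      · exact Or.inl ⟨h1.1.1, h1.1.2.1, h1.1.2.2, h1.2⟩
      · exact Or.inr ⟨rfl, hz⟩
    · rintro (h1 | ⟨rfl, hz⟩)
      · exact Or.inl ⟨⟨h1.1, h1.2.1, h1.2.2.1⟩, h1.2.2.2⟩
      · exact Or.inr ⟨a, hz, rfl, rfl⟩
  have hyne : ∀ {w}, (y, w) ∈ E → w ≠ y ∧ w ≠ x := fun hw =>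
    ⟨(hl _ hw).symm, fun hh => hyx (hh ▸ hw)⟩
  have hnc : ¬ Col n F := by
    rintro ⟨φ, hφ⟩
    have hyw : ∀ w, (y, w) ∈ E → φ w ≠ φ y := fun w hw =>
      hφ.ne_of_digon (memF.2 (Or.inr ⟨rfl, hw⟩))
        (memF.2 (Or.inl ⟨hw, hxney.symm, (hyne hw).2, (hyne hw).1⟩))
    have hφx : Proper (del E {x}) φ := by
      refine Proper.of_del_out (v := y) (hφ.mono fun ⟨a, b⟩ hab => ?_)
        fun w hw => hyw w (mem_del.1 hw).1
      simp only [mem_del, mem_singleton] at hab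
      exact memF.2 (Or.inl ⟨hab.1.1, hab.1.2.1, hab.1.2.2, hab.2.2⟩)
    have hinj := h.crit.injOn_outN hl hx.2.1 hφx
    refine h.crit.not_col ⟨Function.update φ x (φ y), Proper.of_del_out (v := y)
      (Proper.of_del_out (v := x) (Proper.update _ (hφx.mono fun a ha => ?_)) ?_) ?_⟩
    · simp only [mem_del] at ha ⊢
      exact ⟨ha.1.1, ha.2⟩
    · intro w hw
      simp only [mem_del, mem_singleton] at hw
      rw [Function.update_self, Function.update_of_ne (hl _ hw.1).symm]
      exact fun hh => hw.2.2 (hinj (mem_outN.2 hw.1) (mem_outN.2 hxy) hh)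
    · intro w hw
      rw [Function.update_of_ne hxney.symm, Function.update_of_ne (hyne hw).2]
      exact hyw w hw
  obtain ⟨W, hW, hWc⟩ := exists_crit hnc
  have hFl : Loopless F := by
    rintro ⟨a, b⟩ hab hh
    simp only at hh
    subst hh
    rcases memF.1 hab with h1 | ⟨rfl, h1⟩
    · exact hl _ h1.1 rfl
    · exact hl _ h1 rfl
  have hWl := hFl.mono hW
  have hWx : supp W ⊆ (supp E).erase x := by
    rw [supp_subset_iff]
    rintro ⟨a, b⟩ hab
    simp only [mem_erase]
    rcases memF.1 (hW hab) with h1 | ⟨rfl, h1⟩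
    · exact ⟨⟨h1.2.1, fst_mem_supp h1.1⟩, h1.2.2.1, snd_mem_supp h1.1⟩
    · exact ⟨⟨(hyne h1).2, snd_mem_supp h1⟩, hxney.symm, hys⟩
  have hss : supp W ⊂ supp E := hWx.trans_ssubset (erase_ssubset hx.1)
  have hyW : y ∈ supp W := by
    by_contra hyW
    refine hWc.not_col ((h.crit.col_del hx.1).mono fun ⟨a, b⟩ hab => ?_)
    rcases memF.1 (hW hab) with h1 | ⟨rfl, h1⟩
    · simp only [mem_del, mem_singleton]; tauto
    · exact absurd (snd_mem_supp hab) hyW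
  have hout : outN W y = outN E y := by
    refine eq_of_subset_of_card_le (fun w hw => ?_) (hy ▸ hWc.le_outN hWl hyW)
    rw [mem_outN] at hw ⊢
    rcases memF.1 (hW hw) with h1 | ⟨rfl, h1⟩
    exacts [h1.1, h1]
  have hin : inN W y = outN E y := by
    refine eq_of_subset_of_card_le (fun w hw => ?_) (hy ▸ hWc.le_inN hWl hyW)
    rw [mem_inN] at hw
    rw [mem_outN]
    rcases memF.1 (hW hw) with h1 | h1
    exacts [absurd rfl h1.2.2.2, h1.2]
  have hWcard := card_eq_del_add hWl y
  rw [hout, hin, hy] at hWcard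
  have hEl : Loopless (ind E (supp W)) := hl.mono (ind_subset _ _)
  have hEcard := card_eq_del_add hEl y
  have hKW : outN E y ⊆ supp W := hout ▸ outN_subset_supp y
  have hd : del W {y} ⊆ ind E ((supp W).erase y) := fun ⟨a, b⟩ hab => by
    simp only [mem_del, mem_singleton] at hab
    have h1 := fst_mem_supp hab.1
    have h2 := snd_mem_supp hab.1
    simp only [mem_ind, mem_erase]
    rcases memF.1 (hW hab.1) with h3 | h3 <;> tauto
  have hd2 : ind E ((supp W).erase y) ⊆ del (ind E (supp W)) {y} := fun ⟨a, b⟩ hab => by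
    simp only [mem_ind, mem_erase, mem_del, mem_singleton] at hab ⊢
    tauto
  have hdc := card_le_card hd
  have hdc2 := card_le_card hd2
  have ho : n ≤ #(outN (ind E (supp W)) y) := by
    rw [← hy]
    refine card_le_card fun w hw => ?_
    rw [mem_outN] at hw ⊢
    exact mem_ind.2 ⟨hw, hyW, hKW (mem_outN.2 hw)⟩
  have hfew := h.card_ind_add_le hn hWl hWc hss
  have hi : inN (ind E (supp W)) y = ∅ := by
    rw [← card_eq_zero]; omega
  refine ⟨?_, fun z hz hzy => ?_⟩
  · have hP := h.wt_le W hWl hWc (Or.inl (card_lt_card hss))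
    have hKs : outN E y ⊆ (supp W).erase y := fun w hw =>
      mem_erase.2 ⟨(hyne (mem_outN.1 hw)).1, hKW hw⟩
    have hQ : (supp W).erase y ⊂ supp E := (erase_subset _ _).trans_ssubset hss
    have hQc : (#((supp W).erase y) : ℤ) = #(supp W) - 1 := by
      rw [card_erase_of_mem hyW, Nat.cast_sub (card_pos.2 ⟨y, hyW⟩)]; simp
    obtain ⟨h1, h2⟩ := h.isClique_of_wt_le hn hQ (by have := card_le_card hKs; omega) (by
      rw [wt] at hP ⊢
      rw [hQc]
      have h3 : (#W : ℤ) ≤ #(ind E ((supp W).erase y)) + 2 * n := by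
        have : #W ≤ #(ind E ((supp W).erase y)) + 2 * n := by omega
        exact_mod_cast this
      have h4 := mul_le_mul_of_nonneg_left h3 (show (0 : ℤ) ≤ 2 * n by positivity)
      nlinarith)
    exact (eq_of_subset_of_card_le hKs (by omega)) ▸ h2
  · have : z ∈ inN (ind E (supp W)) y :=
      mem_inN.2 (mem_ind.2 ⟨hzy, hKW (mem_outN.2 hz), hyW⟩)
    rw [hi] at this
    exact notMem_empty _ this

/-- Otherwise `u` has fewer than `n` out-neighbours outside the clique `outN E y`, and adding the
reverse arcs separates `u` from them in colour. Then `y` can take the colour of `u`, and `x` the old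
colour of `y`. -/
theorem MinCounterexample.two_mul_le_outN (h : MinCounterexample n E) (hn : 4 ≤ n) {x y : V}
    (hx : IsLow n E x) (hxy : (x, y) ∈ E) (hyx : (y, x) ∉ E) (hy : #(outN E y) = n) {u : V}
    (hu : (y, u) ∈ E) : 2 * n ≤ #(outN E u) + 1 := by
  have hl := h.loopless
  obtain ⟨hK, hdig⟩ := h.isClique_outN hn hx hxy hyx hy
  have hxney : x ≠ y := hl _ hxy
  have huy : u ≠ y := (hl _ hu).symm
  have hux : u ≠ x := fun hh => hyx (hh ▸ hu)
  have huK : u ∈ outN E y := mem_outN.2 hu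
  set O := outN E u \ outN E y with hO
  have hsub : (outN E y).erase u ∪ O ⊆ outN E u := by
    refine union_subset (fun w hw => ?_) sdiff_subset
    rw [mem_erase] at hw
    exact mem_outN.2 (hK u huK w hw.2 hw.1.symm)
  have hc := card_le_card hsub
  rw [card_union_of_disjoint (disjoint_left.2 fun w hw hwO =>
    (mem_sdiff.1 hwO).2 (mem_of_mem_erase hw)), card_erase_of_mem huK, hy] at hc
  by_contra! hlt
  have hOn : #O < n := by rw [← hO] at hc; omega
  -- The deleted `x` will receive the colour of `y`; so if `u` sends an arc to `x`, the digon
  -- between `u` and `y` is completed instead.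
  set F : Finset (V × V) := O.image fun z => if z = x then (u, y) else (z, u) with hF
  have hOu : ∀ z ∈ O, (u, z) ∈ E := fun z hz => mem_outN.1 (mem_sdiff.1 hz).1
  have hFO : ∀ a ∈ F, a = (u, y) ∨ ∃ z ∈ O, z ≠ x ∧ a = (z, u) := by
    intro a ha
    obtain ⟨z, hz, rfl⟩ := mem_image.1 ha
    by_cases hzx : z = x
    · left; simp [hzx]
    · right; exact ⟨z, hz, hzx, by simp [hzx]⟩
  obtain ⟨φ, hφ⟩ := h.col_ind_union hn (R := (supp E).erase x) (F := F) (erase_ssubset hx.1)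
    (by
      intro a ha
      rcases hFO a ha with rfl | ⟨z, hz, -, rfl⟩
      · exact huy
      · exact (hl _ (hOu z hz)).symm)
    (by
      rw [supp_subset_iff]
      intro a ha
      have hus : u ∈ (supp E).erase x := mem_erase.2 ⟨hux, snd_mem_supp hu⟩
      rcases hFO a ha with rfl | ⟨z, hz, hzx, rfl⟩
      · exact ⟨hus, mem_erase.2 ⟨hxney.symm, fst_mem_supp hu⟩⟩
      · exact ⟨mem_erase.2 ⟨hzx, snd_mem_supp (hOu z hz)⟩, hus⟩)
    (card_image_le.trans_lt hOn)
  have hdel : del E {x} ⊆ ind E ((supp E).erase x) := fun a ha => by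
    simp only [mem_del, mem_singleton] at ha
    exact mem_ind.2 ⟨ha.1, mem_erase.2 ⟨ha.2.1, fst_mem_supp ha.1⟩,
      mem_erase.2 ⟨ha.2.2, snd_mem_supp ha.1⟩⟩
  have hmem : ∀ {a b}, (a, b) ∈ E → a ≠ x → b ≠ x → (a, b) ∈ ind E ((supp E).erase x) ∪ F :=
    fun hab ha hb => mem_union_left _ (hdel (by simp [hab, ha, hb]))
  have hφx : Proper (del E {x}) φ := hφ.mono (hdel.trans subset_union_left)
  have hinj := h.crit.injOn_outN hl hx.2.1 hφx
  have hKx : ∀ w ∈ outN E y, w ≠ x ∧ w ≠ y := fun w hw =>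
    ⟨fun hh => hyx (hh ▸ mem_outN.1 hw), (hl _ (mem_outN.1 hw)).symm⟩
  have hKu : ∀ w ∈ outN E y, w ≠ u → φ w ≠ φ u := fun w hw hwu =>
    hφ.ne_of_digon (hmem (hK w hw u huK hwu) (hKx w hw).1 hux)
      (hmem (hK u huK w hw hwu.symm) hux (hKx w hw).1)
  let χ : V → Fin n := fun w => if w = x then φ y else if w = y then φ u else φ w
  have hχx : χ x = φ y := by simp [χ]
  have hχy : χ y = φ u := by simp [χ, hxney.symm]
  have hχ : ∀ w, w ≠ x → w ≠ y → χ w = φ w := fun w h1 h2 => by simp [χ, h1, h2]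
  -- Peeled off in the order `u`, `y`, `x`, each vertex has no out-neighbour of its colour among
  -- those remaining.
  refine h.crit.not_col ⟨χ, Proper.of_del_out (v := u) (Proper.of_del_out (v := y)
    (Proper.of_del_out (v := x) ?_ ?_) ?_) ?_⟩
  · refine (hφx.mono (F := del (del (del E {u}) {y}) {x}) fun a ha => ?_).congr fun a ha => ?_ <;>
      simp only [mem_del, mem_singleton] at ha ⊢
    · tauto
    · exact ⟨hχ _ ha.2.1 ha.1.2.1, hχ _ ha.2.2 ha.1.2.2⟩
  · intro w hw
    simp only [mem_del, mem_singleton] at hw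
    rw [hχx, hχ w (hl _ hw.1.1).symm hw.2.2]
    exact fun hh => hw.2.2 (hinj (mem_outN.2 hw.1.1) (mem_outN.2 hxy) hh)
  · intro w hw
    simp only [mem_del, mem_singleton] at hw
    have hwK := mem_outN.2 hw.1
    rw [hχy, hχ w (hKx w hwK).1 (hKx w hwK).2]
    exact hKu w hwK hw.2.2
  · intro w hw
    rw [hχ u hux huy]
    by_cases hwK : w ∈ outN E y
    · rw [hχ w (hKx w hwK).1 (hKx w hwK).2]
      exact hKu w hwK (hl _ hw).symm
    · have hwO : w ∈ O := mem_sdiff.2 ⟨mem_outN.2 hw, hwK⟩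
      have hwF := mem_image_of_mem (fun z => if z = x then (u, y) else (z, u)) hwO
      by_cases hwx : w = x
      · subst hwx
        simp only [if_true] at hwF
        rw [hχx]
        exact hφ.ne_of_digon (hmem hu hxney.symm hux) (mem_union_right _ hwF)
      · simp only [hwx, if_false] at hwF
        have hwy : w ≠ y := fun hh => hdig u hu (hh ▸ hw)
        rw [hχ w hwx hwy]
        exact hφ.ne_of_digon (mem_union_right _ hwF) (hmem hw hux hwx)

/-! ### The degrees around a low vertex -/

/-- The number of arcs at a vertex. -/
def deg (E : Finset (V × V)) (v : V) : ℕ := #(outN E v) + #(inN E v)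

/-- `v` lies in a clique of order `n`. -/
def InClique (n : ℕ) (E : Finset (V × V)) (v : V) : Prop :=
  ∃ K, v ∈ K ∧ #K = n ∧ IsClique E K

/-- The vertices of `S` have very large degree, and there are at least `n` of them. -/
def Rich (n : ℕ) (E : Finset (V × V)) (S : Finset V) : Prop :=
  n ≤ #S ∧ ∀ u ∈ S, 3 * n ≤ deg E u + 1

theorem deg_rev (E : Finset (V × V)) (v : V) : deg (rev E) v = deg E v := by
  rw [deg, deg, outN_rev, inN_rev, add_comm]

theorem isClique_rev {K : Finset V} : IsClique (rev E) K ↔ IsClique E K :=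
  ⟨fun h u hu v hv huv => mem_rev.1 (h v hv u hu huv.symm),
    fun h u hu v hv huv => mem_rev.2 (h v hv u hu huv.symm)⟩

theorem inClique_rev {v : V} : InClique n (rev E) v ↔ InClique n E v := by
  simp only [InClique, isClique_rev]

/-- Out-degree at least 2n - 1 and in-degree at least n add up to 3n - 1. -/
theorem MinCounterexample.rich_outN (h : MinCounterexample n E) (hn : 4 ≤ n) {x y : V}
    (hx : IsLow n E x) (hxy : (x, y) ∈ E) (hyx : (y, x) ∉ E) (hy : #(outN E y) = n) :
    Rich n E (outN E y) := by
  refine ⟨hy.ge, fun u hu => ?_⟩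
  have h1 := h.two_mul_le_outN hn hx hxy hyx hy (mem_outN.1 hu)
  have h2 := h.crit.le_inN h.loopless (outN_subset_supp y hu)
  rw [deg]; omega

theorem MinCounterexample.rich_inN (h : MinCounterexample n E) (hn : 4 ≤ n) {x y : V}
    (hx : IsLow n E x) (hyx : (y, x) ∈ E) (hxy : (x, y) ∉ E) (hy : #(inN E y) = n) :
    Rich n E (inN E y) := by
  have := h.rev.rich_outN hn (isLow_rev.2 hx) (mem_rev.2 hyx) (fun hh => hxy (mem_rev.1 hh))
    (by rwa [outN_rev])
  rw [outN_rev] at this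
  exact ⟨this.1, fun u hu => by rw [← deg_rev]; exact this.2 u hu⟩

/-- The degrees of a non-low out-neighbour of a low vertex outside all cliques of order `n`. -/
theorem MinCounterexample.le_of_out (h : MinCounterexample n E) (hn : 4 ≤ n) {x v : V}
    (hx : IsLow n E x) (hxK : ¬ InClique n E x) (hxv : (x, v) ∈ E) (hv : 2 * n < deg E v) :
    n ≤ #(inN E v \ Tw E x) ∧ n ≤ #(outN E v \ Tw E x) := by
  by_contra hcon
  have := h.isClique_of_few hn hx hxv hv (by omega)
  exact hxK ⟨_, mem_insert_self _ _,
    (card_insert_erase (notMem_outN h.loopless x) (mem_outN.2 hxv)).trans hx.2.1, this⟩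

theorem card_sdiff_Tw_add {x v : V} (hv : v ∉ Tw E x) (hvx : (v, x) ∈ E) :
    #(outN E v \ Tw E x) + #(Tw E x) = #(outN E v) := by
  refine card_sdiff_add_card_eq_card fun t ht => mem_outN.2 (in_of_mem_Tw ht hvx ?_)
  rintro rfl
  exact hv ht

theorem card_sdiff_Tw_add' {x v : V} (hv : v ∉ Tw E x) (hxv : (x, v) ∈ E) :
    #(inN E v \ Tw E x) + #(Tw E x) = #(inN E v) := by
  refine card_sdiff_add_card_eq_card fun t ht => mem_inN.2 (out_of_mem_Tw ht hxv ?_)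
  rintro rfl
  exact hv ht

/-! ### Discharging -/

/-- The charge that a vertex of degree `d` sends along each of its arcs. -/
def share (n d : ℕ) : ℚ := n - (2 * n ^ 2 + n - 2) / d

theorem share_mono {d e : ℕ} (hn : 4 ≤ n) (hd : 0 < d) (h : d ≤ e) : share n d ≤ share n e := by
  have hnq : (4 : ℚ) ≤ n := by exact_mod_cast hn
  have hdq : (0 : ℚ) < d := by exact_mod_cast hd
  have hde : (d : ℚ) ≤ e := by exact_mod_cast h
  have : (0 : ℚ) ≤ 2 * n ^ 2 + n - 2 := by nlinarith
  exact sub_le_sub_left (div_le_div_of_nonneg_left this hdq hde) _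

theorem mul_share {d : ℕ} (hd : 0 < d) : (d : ℚ) * share n d = n * d - (2 * n ^ 2 + n - 2) := by
  have hdq : (d : ℚ) ≠ 0 := by exact_mod_cast hd.ne'
  rw [share]; field_simp

theorem share_two_mul_add_two : (n + 1) * share n (2 * n + 2) = ((n : ℚ) + 2) / 2 := by
  rw [share]; push_cast; field_simp; ring

theorem share_nonneg (hn : 4 ≤ n) {d : ℕ} (hd : 2 * n + 2 ≤ d) : 0 ≤ share n d := by
  refine le_trans ?_ (share_mono hn (by omega) hd)
  have h := share_two_mul_add_two (n := n)
  by_contra! hlt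
  have hnq : (4 : ℚ) ≤ n := by exact_mod_cast hn
  nlinarith

/-- So `n` rich neighbours pay the debt n - 2 of a low vertex. -/
theorem le_mul_share_of_rich (hn : 4 ≤ n) {d : ℕ} (hd : 3 * n ≤ d + 1) :
    ((n : ℚ) - 2) / n ≤ share n d := by
  have hnq : (4 : ℚ) ≤ n := by exact_mod_cast hn
  have hdq : (3 * n - 1 : ℚ) ≤ d := by
    have : (3 * n : ℚ) ≤ d + 1 := by exact_mod_cast hd
    linarith
  have hd0 : (0 : ℚ) < d := by linarith
  have hn0 : (0 : ℚ) < n := by linarith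
  rw [share, div_le_iff₀ hn0, sub_mul, div_mul_eq_mul_div, le_sub_iff_add_le, ← le_sub_iff_add_le',
    div_le_iff₀ hd0]
  nlinarith [mul_le_mul_of_nonneg_left hdq (show (0 : ℚ) ≤ n * n - (n - 2) by nlinarith),
    mul_nonneg (sub_nonneg.2 hnq) (mul_nonneg hn0.le hn0.le), mul_nonneg (sub_nonneg.2 hnq) hn0.le]

/-- The case of a low vertex without other twins, paid along all its 2n arcs. -/
theorem le_share_single (hn : 4 ≤ n) : (n : ℚ) - 2 ≤ 2 * n * share n (2 * n + 2) := by
  have hnq : (4 : ℚ) ≤ n := by exact_mod_cast hn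
  have h := share_two_mul_add_two (n := n)
  have h2 : share n (2 * n + 2) = ((n : ℚ) + 2) / 2 / (n + 1) := by
    rw [← h]; field_simp
  rw [h2, mul_div_assoc', le_div_iff₀ (by linarith)]
  nlinarith

/-- Here `s` is the size of a twin class, which leaves at least 2n + 2 - 2s arcs to vertices outside
it. -/
theorem le_share_cluster (hn : 4 ≤ n) {s : ℕ} (hs : 2 ≤ s) (hsn : s < n) :
    (n : ℚ) - 2 ≤ (2 * n + 2 - 2 * s) * share n (2 * n + s) := by
  have hnq : (4 : ℚ) ≤ n := by exact_mod_cast hn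
  have hsq : (2 : ℚ) ≤ s := by exact_mod_cast hs
  have hsnq : (s : ℚ) + 1 ≤ n := by exact_mod_cast hsn
  have hpos : (0 : ℚ) < 2 * n + s := by linarith
  have h2 : share n (2 * n + s) = (n * (s - 1) + 2 : ℚ) / (2 * n + s) := by
    rw [share]; push_cast; field_simp; ring
  rw [h2, mul_div_assoc', le_div_iff₀ hpos]
  have h3 := mul_nonneg (sub_nonneg.2 hsq) (sub_nonneg.2 hsnq)
  nlinarith [mul_nonneg h3 (show (0 : ℚ) ≤ n by linarith)]

theorem share_clique (s : ℕ) (hn : 4 ≤ n) :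
    2 * share n (2 * n + 2 * s) = (n * (2 * s - 1) + 2 : ℚ) / (n + s) := by
  have hnq : (4 : ℚ) ≤ n := by exact_mod_cast hn
  have hpos : (0 : ℚ) < n + s := by positivity
  rw [share]; push_cast
  rw [show (2 * n + 2 * s : ℚ) = 2 * (n + s) by ring]
  field_simp; ring

theorem le_share_clique_one (hn : 4 ≤ n) :
    (n : ℚ) - 2 ≤ (n - 1) * (2 * share n (2 * n + 2 * 1)) := by
  have hnq : (4 : ℚ) ≤ n := by exact_mod_cast hn
  rw [share_clique 1 hn, mul_div_assoc', le_div_iff₀ (by push_cast; linarith)]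
  push_cast; nlinarith

/-- In a clique of order `n`, a low vertex with `t` twins (itself included) is paid by the n - t
others through digons. The surplus (n - 2)/t is what it may have to forward. -/
theorem le_share_clique (hn : 4 ≤ n) {t : ℕ} (ht : 2 ≤ t) (htn : t < n) :
    (n : ℚ) - 2 + (n - 2) / t ≤ (n - t) * (2 * share n (2 * n + 2 * t)) := by
  have htq : (2 : ℚ) ≤ t := by exact_mod_cast ht
  have htnq : (t : ℚ) + 1 ≤ n := by exact_mod_cast htn
  have hpos : (0 : ℚ) < n + t := by linarith
  have ht0 : (0 : ℚ) < t := by linarith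
  rw [share_clique t hn, mul_div_assoc', le_div_iff₀ hpos,
    show ((n : ℚ) - 2 + (n - 2) / t) = ((t + 1) * (n - 2)) / t by field_simp,
    div_mul_eq_mul_div, div_le_iff₀ ht0]
  -- In the nonnegative parameters p = t - 2 and q = n - t - 1 the inequality has only nonnegative
  -- coefficients.
  obtain ⟨p, hp, htp⟩ : ∃ p : ℚ, 0 ≤ p ∧ (t : ℚ) = p + 2 := ⟨t - 2, by linarith, by ring⟩
  obtain ⟨q, hq, hqn⟩ : ∃ q : ℚ, 0 ≤ q ∧ (n : ℚ) = t + 1 + q := ⟨n - t - 1, by linarith, by ring⟩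
  have h0 : 0 ≤ 3 * p + 12 * p ^ 2 * q + 21 * p * q + 2 * p ^ 3 * q + 2 * p ^ 2 * q ^ 2 +
      6 * p * q ^ 2 + 7 + 10 * q + 3 * q ^ 2 := by positivity
  rw [hqn, htp]
  linarith

/-! #### The cliques of order `n` around a low vertex -/

/-- The structure around a low vertex in a clique of order `n`. -/
theorem MinCounterexample.low_inClique (h : MinCounterexample n E) (hn : 4 ≤ n) {u : V}
    (hu : IsLow n E u) (huK : InClique n E u) :
    ∃ K v, #K = n ∧ Tw E u ⊂ K ∧ outN E u = insert v (K.erase u) ∧ IsClique E K ∧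
      (∀ w ∈ K \ Tw E u, (u, w) ∈ E ∧ (w, u) ∈ E ∧ 2 * n + 2 * #(Tw E u) ≤ deg E w) := by
  have hl := h.loopless
  obtain ⟨K, huK, hKn, hK⟩ := huK
  obtain ⟨v, hvK, hv⟩ := h.exists_apex hn hK hKn huK hu
  have huv : (u, v) ∈ E := mem_outN.1 ((hv u huK hu).1 ▸ mem_insert_self _ _)
  have hvu : (v, u) ∈ E := mem_inN.1 ((hv u huK hu).2 ▸ mem_insert_self _ _)
  have hnoK : ¬ IsClique E (insert v K) := fun hh => by
    have := h.card_clique_le hn hh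
    rw [card_insert_of_notMem hvK] at this
    omega
  have hclique : (∀ k ∈ K, (k, v) ∈ E ∧ (v, k) ∈ E) → IsClique E (insert v K) := by
    intro hall a ha b hb hab
    rw [mem_insert] at ha hb
    rcases ha with rfl | ha <;> rcases hb with rfl | hb
    exacts [absurd rfl hab, (hall b hb).2, (hall a ha).1, hK a ha b hb hab]
  have hlowT : ∀ w ∈ K, IsLow n E w → w ∈ Tw E u := by
    intro w hw hwl
    refine mem_Tw.2 ⟨hwl.1, sig_eq_iff.2 ?_⟩
    rw [(hv w hw hwl).1, (hv w hw hwl).2, (hv u huK hu).1, (hv u huK hu).2,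
      insert_comm, insert_erase hw, insert_comm u, insert_erase huK]
    exact ⟨rfl, rfl⟩
  have hvT : v ∉ Tw E u := fun hvT => by
    refine hnoK (hclique fun k hk => ?_)
    by_cases hku : k = u
    · subst hku; exact ⟨huv, hvu⟩
    · have hkv : k ≠ v := fun hh => hvK (hh ▸ hk)
      exact ⟨in_of_mem_Tw hvT (hK k hk u huK hku) hkv,
        out_of_mem_Tw hvT (hK u huK k hk (Ne.symm hku)) hkv⟩
  have hTK : Tw E u ⊆ K := by
    intro w hw
    by_cases hwu : w = u
    · rwa [hwu]
    · have : w ∈ insert v (K.erase u) :=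
        (hv u huK hu).1 ▸ mem_outN.2 (mem_of_mem_Tw hw hwu).2
      rw [mem_insert, mem_erase] at this
      rcases this with rfl | h1
      exacts [absurd hw hvT, h1.2]
  have hTne : Tw E u ≠ K := by
    intro hTK
    refine hnoK (hclique fun k hk => ?_)
    have hkl := hu.of_mem_Tw hl (hTK ▸ hk)
    exact ⟨mem_outN.1 ((hv k hk hkl).1 ▸ mem_insert_self _ _),
      mem_inN.1 ((hv k hk hkl).2 ▸ mem_insert_self _ _)⟩
  refine ⟨K, v, hKn, hTK.ssubset_of_ne hTne, (hv u huK hu).1, hK, fun w hw => ?_⟩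
  rw [mem_sdiff] at hw
  have hwu : w ≠ u := fun hh => hw.2 (by rw [hh]; exact self_mem_Tw hu.1)
  have huw := hK u huK w hw.1 hwu.symm
  have hwu' := hK w hw.1 u huK hwu
  refine ⟨huw, hwu', ?_⟩
  have hws : w ∈ supp E := snd_mem_supp huw
  have hwout := h.crit.le_outN hl hws
  have hwin := h.crit.le_inN hl hws
  have hwdeg : 2 * n < deg E w := by
    by_contra! hle
    rw [deg] at hle
    exact hw.2 (hlowT w hw.1 ⟨hws, by omega, by omega⟩)
  have e1 := card_sdiff_Tw_add hw.2 hwu'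
  have e2 := card_sdiff_Tw_add' hw.2 huw
  by_contra! hlt
  rw [deg] at hlt
  -- In some direction `w` has fewer than `n` neighbours outside the twins of `u`. So exchanging `w`
  -- for `v` gives another clique, and `insert v K` lacks at most the two arcs between `v` and `w`:
  -- its potential is too small.
  have hcl := h.isClique_of_few hn hu huw hwdeg (by omega)
  rw [(hv u huK hu).1] at hcl
  have hvw : v ≠ w := fun hh => hvK (hh ▸ hw.1)
  have hQ : (insert v K).offDiag \ {(v, w), (w, v)} ⊆ ind E (insert v K) := by
    rintro ⟨a, b⟩ hab
    simp only [mem_sdiff, mem_offDiag, mem_insert, mem_singleton, Prod.mk.injEq, not_or,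
      not_and] at hab
    refine mem_ind.2 ⟨?_, mem_insert.2 hab.1.1, mem_insert.2 hab.1.2.1⟩
    by_cases hav : a = v ∨ b = v
    · refine hcl a ?_ b ?_ hab.1.2.2 <;> simp only [mem_insert, mem_erase]
      · by_cases hau : a = u
        · exact Or.inl hau
        · refine Or.inr ⟨?_, ?_⟩
          · rintro rfl
            rcases hav with rfl | rfl
            · exact hvw rfl
            · exact hab.2.2 rfl rfl
          · have := hab.1.1; tauto
      · by_cases hbu : b = u
        · exact Or.inl hbu
        · refine Or.inr ⟨?_, ?_⟩
          · rintro rfl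
            rcases hav with rfl | rfl
            · exact hab.2.1 rfl rfl
            · exact hvw rfl
          · have := hab.1.2.1; tauto
    · push Not at hav
      exact hK a (hab.1.1.resolve_left hav.1) b (hab.1.2.1.resolve_left hav.2) hab.1.2.2
  have hQs : insert v K ⊆ supp E := by
    refine insert_subset (snd_mem_supp huv) fun k hk => ?_
    by_cases hku : k = u
    · exact hku ▸ hu.1
    · exact fst_mem_supp (hK k hk u huK hku)
  have hQc : #(insert v K) = n + 1 := by rw [card_insert_of_notMem hvK, hKn]
  -- On only n + 1 vertices, the degree of `w` could not exceed 2n.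
  by_cases hQeq : insert v K = supp E
  · have hN : ∀ S ⊆ supp E, w ∉ S → #S ≤ n := fun S hS hwS => by
      have := card_le_card (show S ⊆ (supp E).erase w from fun z hz =>
        mem_erase.2 ⟨fun hh => hwS (hh ▸ hz), hS hz⟩)
      rw [card_erase_of_mem hws, ← hQeq, hQc] at this
      omega
    have h1 := hN _ (outN_subset_supp w) (notMem_outN hl w)
    have h2 := hN _ (inN_subset_supp w) (notMem_inN hl w)
    rw [deg] at hwdeg
    omega
  · have h1 := h.le_wt_ind hn (hQs.ssubset_of_ne hQeq) (by omega)
    have h2 := card_le_card hQ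
    have h3 := le_card_sdiff {(v, w), (w, v)} (insert v K).offDiag
    have h4 : #({(v, w), (w, v)} : Finset (V × V)) ≤ 2 := card_le_two
    rw [offDiag_card, hQc] at h3
    have h5 : (n + 1) * (n + 1) ≤ #(ind E (insert v K)) + (n + 1) + 2 := by omega
    have h6 : ((n : ℤ) + 1) * (n + 1) ≤ #(ind E (insert v K)) + (n + 1) + 2 := by exact_mod_cast h5
    rw [wt, hQc] at h1
    have hnz : (4 : ℤ) ≤ n := by exact_mod_cast hn
    have h7 := mul_le_mul_of_nonneg_left h6 (show (0 : ℤ) ≤ 2 * n by positivity)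
    push_cast at h1
    nlinarith

/-! #### The flow of charge -/

/-- The number of arcs between `u` and `x`. -/
def arcsBetween (E : Finset (V × V)) (u x : V) : ℚ :=
  (if (u, x) ∈ E then 1 else 0) + (if (x, u) ∈ E then 1 else 0)

open Classical in
/-- The charge sent from `u` to `x`. -/
noncomputable def flow (n : ℕ) (E : Finset (V × V)) (u x : V) : ℚ :=
  if 2 * n + 2 ≤ deg E u then arcsBetween E u x * share n (deg E u)
  else if deg E u = 2 * n + 1 then
    (if (x, u) ∈ E ∧ IsLow n E x ∧ #(outN E u) = n ∧ Rich n E (outN E u)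
      then share n (2 * n + 2) else 0) +
    (if (u, x) ∈ E ∧ IsLow n E x ∧ #(inN E u) = n ∧ Rich n E (inN E u)
      then share n (2 * n + 2) else 0)
  else if InClique n E u ∧ ¬ InClique n E x ∧ IsLow n E x ∧ (u, x) ∈ E ∧ (x, u) ∈ E ∧ x ∉ Tw E u
    then ((n : ℚ) - 2) / #(Tw E u)
  else 0

theorem arcsBetween_nonneg (E : Finset (V × V)) (u x : V) : 0 ≤ arcsBetween E u x := by
  rw [arcsBetween]; positivity

theorem arcsBetween_le (E : Finset (V × V)) (u x : V) : arcsBetween E u x ≤ 2 := by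
  rw [arcsBetween]; split_ifs <;> norm_num

theorem arcsBetween_comm (E : Finset (V × V)) (u x : V) :
    arcsBetween E u x = arcsBetween E x u := add_comm _ _

theorem one_le_arcsBetween {u x : V} (h : (u, x) ∈ E ∨ (x, u) ∈ E) : 1 ≤ arcsBetween E u x := by
  rw [arcsBetween]
  rcases h with h | h <;> rw [if_pos h] <;> split_ifs <;> norm_num

theorem arcsBetween_digon {u x : V} (h : (u, x) ∈ E) (h' : (x, u) ∈ E) :
    arcsBetween E u x = 2 := by
  rw [arcsBetween, if_pos h, if_pos h']; norm_num

theorem sum_ite_outN (u : V) (c : ℚ) :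
    ∑ x ∈ supp E, (if (u, x) ∈ E then c else 0) = #(outN E u) * c := by
  rw [← sum_filter, sum_const, nsmul_eq_mul]
  congr 3
  ext x
  rw [mem_filter, mem_outN]
  exact ⟨fun h => h.2, fun h => ⟨snd_mem_supp h, h⟩⟩

theorem sum_ite_inN (u : V) (c : ℚ) :
    ∑ x ∈ supp E, (if (x, u) ∈ E then c else 0) = #(inN E u) * c := by
  rw [← sum_filter, sum_const, nsmul_eq_mul]
  congr 3
  ext x
  rw [mem_filter, mem_inN]
  exact ⟨fun h => h.2, fun h => ⟨fst_mem_supp h, h⟩⟩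

theorem sum_arcsBetween (u : V) : ∑ x ∈ supp E, arcsBetween E u x = deg E u := by
  simp only [arcsBetween, sum_add_distrib, sum_ite_outN, sum_ite_inN, deg]
  push_cast; ring

theorem sum_card_outN (E : Finset (V × V)) : ∑ u ∈ supp E, #(outN E u) = #E := by
  rw [card_eq_sum_card_fiberwise (f := Prod.fst) (t := supp E) fun a ha => fst_mem_supp ha]
  refine sum_congr rfl fun u _ => (card_image_of_injOn ?_)
  rintro ⟨a, b⟩ ha ⟨c, d⟩ hc (rfl : b = d)
  have h1 := (mem_filter.1 (mem_coe.1 ha)).2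
  have h2 := (mem_filter.1 (mem_coe.1 hc)).2
  exact Prod.ext (h1.trans h2.symm) rfl

theorem sum_deg (E : Finset (V × V)) : ∑ u ∈ supp E, deg E u = 2 * #E := by
  simp only [deg, sum_add_distrib]
  rw [sum_card_outN]
  have := sum_card_outN (rev E)
  rw [supp_rev, card_rev] at this
  simp only [outN_rev] at this
  omega

theorem flow_nonneg (hn : 4 ≤ n) (u x : V) : 0 ≤ flow n E u x := by
  have hc := share_nonneg hn (le_refl (2 * n + 2))
  have hnq : (4 : ℚ) ≤ n := by exact_mod_cast hn
  rw [flow]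
  split_ifs with h
  · exact mul_nonneg (arcsBetween_nonneg _ _ _) (share_nonneg hn h)
  all_goals first | positivity | exact div_nonneg (by linarith) (by positivity)

theorem flow_of_le {u : V} (hu : 2 * n + 2 ≤ deg E u) (x : V) :
    flow n E u x = arcsBetween E u x * share n (deg E u) := by rw [flow, if_pos hu]

theorem IsLow.deg_eq {u : V} (hu : IsLow n E u) : deg E u = 2 * n := by
  rw [deg, hu.2.1, hu.2.2]; ring

theorem IsLow.flow_eq {u : V} (hu : IsLow n E u) (x : V) [Decidable (InClique n E u ∧
    ¬ InClique n E x ∧ IsLow n E x ∧ (u, x) ∈ E ∧ (x, u) ∈ E ∧ x ∉ Tw E u)] :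
    flow n E u x = if InClique n E u ∧ ¬ InClique n E x ∧ IsLow n E x ∧ (u, x) ∈ E ∧ (x, u) ∈ E ∧
      x ∉ Tw E u then ((n : ℚ) - 2) / #(Tw E u) else 0 := by
  rw [flow, if_neg (by rw [hu.deg_eq]; omega), if_neg (by rw [hu.deg_eq]; omega)]
  congr

theorem sum_flow_le (hn : 4 ≤ n) {S : Finset V} (hS : S ⊆ supp E) (u : V) :
    ∑ x ∈ S, flow n E x u ≤ ∑ x ∈ supp E, flow n E x u :=
  sum_le_sum_of_subset_of_nonneg hS fun x _ _ => flow_nonneg hn x u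

theorem le_sum_flow_of_rich (hn : 4 ≤ n) {u : V} {S : Finset V} (hS : S ⊆ supp E)
    (hr : Rich n E S) (hu : ∀ x ∈ S, (u, x) ∈ E ∨ (x, u) ∈ E) :
    (n : ℚ) - 2 ≤ ∑ x ∈ supp E, flow n E x u := by
  have hnq : (4 : ℚ) ≤ n := by exact_mod_cast hn
  have hSq : (n : ℚ) ≤ #S := by exact_mod_cast hr.1
  refine le_trans ?_ (sum_flow_le hn hS u)
  have h0 : (0 : ℚ) ≤ (n - 2) / n := div_nonneg (by linarith) (by linarith)
  calc (n : ℚ) - 2 = n * ((n - 2) / n) := by field_simp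
    _ ≤ #S * ((n - 2) / n) := mul_le_mul_of_nonneg_right hSq h0
    _ = ∑ x ∈ S, ((n : ℚ) - 2) / n := by rw [sum_const, nsmul_eq_mul]
    _ ≤ ∑ x ∈ S, flow n E x u := by
      refine sum_le_sum fun x hx => ?_
      have hd := hr.2 x hx
      rw [flow_of_le (by omega)]
      have h1 := le_mul_share_of_rich hn hd
      have h2 := one_le_arcsBetween (hu x hx).symm
      nlinarith

/-- The balance at a vertex of degree at least `2 * n + 2`. -/
theorem sum_flow_of_le {u : V} (hu : 2 * n + 2 ≤ deg E u) :
    ∑ x ∈ supp E, flow n E u x = n * deg E u - (2 * n ^ 2 + n - 2) := by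
  simp only [flow_of_le hu, ← sum_mul, sum_arcsBetween]
  exact mul_share (by omega)

/-- The balance at a vertex of degree `2 * n + 1`. -/
theorem MinCounterexample.sum_flow_le_of_deg_eq (h : MinCounterexample n E) (hn : 4 ≤ n) {u : V}
    (hus : u ∈ supp E) (hu : deg E u = 2 * n + 1) :
    ∑ x ∈ supp E, flow n E u x ≤ 2 + ∑ x ∈ supp E, flow n E x u := by
  have hnq : (4 : ℚ) ≤ n := by exact_mod_cast hn
  have hc := share_nonneg hn (le_refl (2 * n + 2))
  have hc2 := share_two_mul_add_two (n := n)
  have ho := h.crit.le_outN h.loopless hus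
  have hi := h.crit.le_inN h.loopless hus
  have hin : 0 ≤ ∑ x ∈ supp E, flow n E x u := sum_nonneg fun x _ => flow_nonneg hn x u
  have hdeg := hu
  rw [deg] at hdeg
  by_cases h1 : #(outN E u) = n ∧ Rich n E (outN E u)
  · have hr := le_sum_flow_of_rich hn (outN_subset_supp u) h1.2 fun x hx => Or.inl (mem_outN.1 hx)
    -- Only the n + 1 arcs of the larger direction carry charge, (n + 2)/2 in total; the own charge
    -- 2 and the n - 2 from the rich side cover it.
    have : ∑ x ∈ supp E, flow n E u x ≤ (n + 1) * share n (2 * n + 2) := by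
      calc _ ≤ ∑ x ∈ supp E, (if (x, u) ∈ E then share n (2 * n + 2) else 0) := by
            refine sum_le_sum fun x _ => ?_
            rw [flow, if_neg (by omega), if_pos hu,
              if_neg (c := (u, x) ∈ E ∧ _) (fun hh => by omega), add_zero]
            split_ifs <;> first | exact le_rfl | exact hc | tauto
        _ = _ := by
            rw [sum_ite_inN, show #(inN E u) = n + 1 by omega]; push_cast; rfl
    linarith
  · by_cases h2 : #(inN E u) = n ∧ Rich n E (inN E u)
    · have hr := le_sum_flow_of_rich hn (inN_subset_supp u) h2.2 fun x hx => Or.inr (mem_inN.1 hx)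
      have : ∑ x ∈ supp E, flow n E u x ≤ (n + 1) * share n (2 * n + 2) := by
        calc _ ≤ ∑ x ∈ supp E, (if (u, x) ∈ E then share n (2 * n + 2) else 0) := by
              refine sum_le_sum fun x _ => ?_
              rw [flow, if_neg (by omega), if_pos hu,
                if_neg (c := (x, u) ∈ E ∧ _) (fun hh => h1 hh.2.2), zero_add]
              split_ifs <;> first | exact le_rfl | exact hc | tauto
          _ = _ := by
              rw [sum_ite_outN, show #(outN E u) = n + 1 by omega]; push_cast; rfl
      linarith
    · have : ∑ x ∈ supp E, flow n E u x = 0 := sum_eq_zero fun x _ => by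
        rw [flow, if_neg (by omega), if_pos hu, if_neg fun hh => h1 hh.2.2,
          if_neg fun hh => h2 hh.2.2, add_zero]
      linarith

/-- The balance at a low vertex in a clique of order `n`. -/
theorem MinCounterexample.sum_flow_le_of_inClique (h : MinCounterexample n E) (hn : 4 ≤ n) {u : V}
    (hu : IsLow n E u) (huK : InClique n E u) :
    (n - 2 : ℚ) + ∑ x ∈ supp E, flow n E u x ≤ ∑ x ∈ supp E, flow n E x u := by
  classical
  have hnq : (4 : ℚ) ≤ n := by exact_mod_cast hn
  obtain ⟨K, v, hKn, hTK, hout, hK, hw⟩ := h.low_inClique hn hu huK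
  set t := #(Tw E u) with ht
  have htn : t < n := hKn ▸ card_lt_card hTK
  have hKt : #(K \ Tw E u) = n - t := by rw [card_sdiff_of_subset hTK.1, hKn]
  have hin : ((n : ℚ) - t) * (2 * share n (2 * n + 2 * t)) ≤ ∑ x ∈ supp E, flow n E x u := by
    calc _ = ∑ x ∈ K \ Tw E u, 2 * share n (2 * n + 2 * t) := by
          rw [sum_const, nsmul_eq_mul, hKt, Nat.cast_sub htn.le]
      _ ≤ ∑ x ∈ K \ Tw E u, flow n E x u := by
          refine sum_le_sum fun x hx => ?_
          obtain ⟨hux, hxu, hd⟩ := hw x hx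
          have ht1 : 1 ≤ t := card_pos.2 ⟨u, self_mem_Tw hu.1⟩
          rw [flow_of_le (by omega), arcsBetween_digon hxu hux]
          exact mul_le_mul_of_nonneg_left (share_mono hn (by omega) hd) (by norm_num)
      _ ≤ _ := sum_flow_le hn (fun x hx => snd_mem_supp (hw x hx).1) u
  have ht1 : 1 ≤ t := card_pos.2 ⟨u, self_mem_Tw hu.1⟩
  by_cases hP : InClique n E u ∧ ¬ InClique n E v ∧ IsLow n E v ∧ (u, v) ∈ E ∧ (v, u) ∈ E ∧
      v ∉ Tw E u
  · obtain ⟨-, hvK, hv, huv, hvu, hvT⟩ := hP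
    -- If `u` were its only twin, `v` would have at least as many twins and so lie in a clique of
    -- order `n`.
    have ht2 : 2 ≤ t := by
      by_contra! hlt
      have huT : u ∉ Tw E v := fun hh => hvT (by rw [Tw_eq_of_mem hh]; exact self_mem_Tw hv.1)
      have hv1 : 1 ≤ #(Tw E v) := card_pos.2 ⟨v, self_mem_Tw hv.1⟩
      have := h.isClique_of_twins hn hv hu hvu huv huT (by omega)
      exact hvK ⟨_, mem_insert_self _ _, (card_insert_erase (notMem_outN h.loopless v)
        (mem_outN.2 hvu)).trans hv.2.1, this⟩
    -- Only `v` can receive anything: the other out-neighbours of `u` are in `K`, hence in a clique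
    -- of order `n`.
    have : ∑ x ∈ supp E, flow n E u x ≤ ((n : ℚ) - 2) / t := by
      have h0 : (0 : ℚ) ≤ (n - 2) / t := div_nonneg (by linarith) (by positivity)
      calc _ ≤ ∑ x ∈ supp E, if x = v then ((n : ℚ) - 2) / t else 0 := by
            refine sum_le_sum fun x _ => ?_
            rw [hu.flow_eq]
            split_ifs with h1 h2 <;> try first | exact le_rfl | exact h0
            have : x ∈ insert v (K.erase u) := hout ▸ mem_outN.2 h1.2.2.2.1
            exact absurd ⟨K, mem_of_mem_erase ((mem_insert.1 this).resolve_left h2), hKn, hK⟩ h1.2.1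
        _ = _ := by rw [sum_ite_eq', if_pos hv.1]
    linarith [le_share_clique hn ht2 htn]
  · have : ∑ x ∈ supp E, flow n E u x = 0 := sum_eq_zero fun x _ => by
      rw [hu.flow_eq, if_neg]
      intro hx
      have : x ∈ insert v (K.erase u) := hout ▸ mem_outN.2 hx.2.2.2.1
      rcases mem_insert.1 this with rfl | h2
      · exact hP hx
      · exact hx.2.1 ⟨K, mem_of_mem_erase h2, hKn, hK⟩
    rw [this]
    rcases ht1.eq_or_lt with h1 | h2
    · have := le_share_clique_one hn
      rw [← h1] at hin
      push_cast at hin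
      linarith
    · have := le_share_clique hn h2 htn
      have h0 : (0 : ℚ) ≤ (n - 2) / t := div_nonneg (by linarith) (by positivity)
      linarith

/-- A low vertex outside all cliques of order `n`, joined in both directions to a low vertex that is
not a twin. -/
theorem MinCounterexample.le_sum_flow_of_low_digon (h : MinCounterexample n E) (hn : 4 ≤ n)
    {u y : V}
    (hu : IsLow n E u) (huK : ¬ InClique n E u) (hy : IsLow n E y) (huy : (u, y) ∈ E)
    (hyu : (y, u) ∈ E) (hyT : y ∉ Tw E u) : (n - 2 : ℚ) ≤ ∑ x ∈ supp E, flow n E x u := by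
  classical
  have hl := h.loopless
  have huT : u ∉ Tw E y := fun hh => hyT (by rw [Tw_eq_of_mem hh]; exact self_mem_Tw hy.1)
  have hlt : #(Tw E u) < #(Tw E y) := by
    by_contra! hle
    exact huK ⟨_, mem_insert_self _ _, (card_insert_erase (notMem_outN hl u)
      (mem_outN.2 huy)).trans hu.2.1, h.isClique_of_twins hn hu hy huy hyu hyT hle⟩
  have hyK : InClique n E y := ⟨_, mem_insert_self _ _, (card_insert_erase (notMem_outN hl y)
      (mem_outN.2 hyu)).trans hy.2.1, h.isClique_of_twins hn hy hu hyu huy huT hlt.le⟩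
  obtain ⟨K, -, hKn, hTK, -, hK, -⟩ := h.low_inClique hn hy hyK
  have hpos : (#(Tw E y) : ℚ) ≠ 0 := by
    have : #(Tw E y) ≠ 0 := by omega
    exact_mod_cast this
  -- All twins of `y` are joined to `u` in both directions, and their equal contributions add up to
  -- the whole debt.
  calc (n - 2 : ℚ) = ∑ x ∈ Tw E y, ((n : ℚ) - 2) / #(Tw E y) := by
        rw [sum_const, nsmul_eq_mul]; field_simp
    _ ≤ ∑ x ∈ Tw E y, flow n E x u := by
        refine sum_le_sum fun x hx => ?_
        have hux : u ≠ x := fun hh => huT (hh ▸ hx)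
        rw [(hy.of_mem_Tw hl hx).flow_eq, Tw_eq_of_mem hx, if_pos]
        exact ⟨⟨K, hTK.1 hx, hKn, hK⟩, huK, hu, out_of_mem_Tw hx hyu hux,
          in_of_mem_Tw hx huy hux, huT⟩
    _ ≤ _ := sum_flow_le hn (fun x hx => (mem_Tw.1 hx).1) u

/-- Of the 2n arcs at `u`, at most two go to or from each of its |Tw u| - 1 other twins. -/
theorem sum_arcsBetween_sdiff_Tw (hl : Loopless E) {u : V} (hu : IsLow n E u) :
    (2 * n + 2 - 2 * #(Tw E u) : ℚ) ≤ ∑ y ∈ supp E \ Tw E u, arcsBetween E u y := by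
  have hsub : Tw E u ⊆ supp E := fun x hx => (mem_Tw.1 hx).1
  have h1 := sum_sdiff (f := arcsBetween E u) hsub
  rw [sum_arcsBetween, hu.deg_eq] at h1
  have hself : arcsBetween E u u = 0 := by
    have : (u, u) ∉ E := fun hh => hl _ hh rfl
    simp [arcsBetween, this]
  have h2 : ∑ y ∈ Tw E u, arcsBetween E u y ≤ 2 * #(Tw E u) - 2 := by
    rw [← add_sum_erase _ _ (self_mem_Tw hu.1), hself, zero_add]
    calc _ ≤ ∑ y ∈ (Tw E u).erase u, (2 : ℚ) := sum_le_sum fun y _ => arcsBetween_le _ _ _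
      _ = _ := by
        rw [sum_const, nsmul_eq_mul, ← card_erase_add_one (self_mem_Tw hu.1)]; push_cast; ring
  push_cast at h1
  linarith

/-- The balance at a low vertex outside all cliques of order `n`. -/
theorem MinCounterexample.le_sum_flow (h : MinCounterexample n E) (hn : 4 ≤ n) {u : V}
    (hu : IsLow n E u) (huK : ¬ InClique n E u) :
    (n - 2 : ℚ) ≤ ∑ x ∈ supp E, flow n E x u := by
  have hl := h.loopless
  -- A low non-twin neighbour settles the debt: through its twin class if joined by a digon, and
  -- through rich neighbours of `u` if joined by a single arc.
  by_cases hcase : ∃ y, IsLow n E y ∧ y ∉ Tw E u ∧ ((u, y) ∈ E ∨ (y, u) ∈ E)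
  · obtain ⟨y, hy, hyT, hadj⟩ := hcase
    by_cases huy : (u, y) ∈ E <;> by_cases hyu : (y, u) ∈ E
    · exact h.le_sum_flow_of_low_digon hn hu huK hy huy hyu hyT
    · exact le_sum_flow_of_rich hn (inN_subset_supp u) (h.rich_inN hn hy huy hyu hu.2.2)
        fun x hx => Or.inr (mem_inN.1 hx)
    · exact le_sum_flow_of_rich hn (outN_subset_supp u) (h.rich_outN hn hy hyu huy hu.2.1)
        fun x hx => Or.inl (mem_outN.1 hx)
    · tauto
  push Not at hcase
  have hs1 : 1 ≤ #(Tw E u) := card_pos.2 ⟨u, self_mem_Tw hu.1⟩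
  have hsn : #(Tw E u) < n := by
    by_contra! hle
    have h1 := h.card_clique_le hn (isClique_Tw (E := E) u)
    exact huK ⟨_, self_mem_Tw hu.1, h1.antisymm hle, isClique_Tw u⟩
  have hnonlow : ∀ y ∈ supp E, y ∉ Tw E u → ((u, y) ∈ E ∨ (y, u) ∈ E) → 2 * n < deg E y := by
    intro y hy hyT hadj
    have ho := h.crit.le_outN hl hy
    have hi := h.crit.le_inN hl hy
    by_contra! hle
    rw [deg] at hle
    have := hcase y ⟨hy, by omega, by omega⟩ hyT
    tauto
  have hO : ∀ y ∈ supp E, y ∉ Tw E u → (u, y) ∈ E → n + #(Tw E u) ≤ #(inN E y) := by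
    intro y hy hyT huy
    have h1 := h.le_of_out hn hu huK huy (hnonlow y hy hyT (Or.inl huy))
    have h2 := card_sdiff_Tw_add' hyT huy
    omega
  have hI : ∀ y ∈ supp E, y ∉ Tw E u → (y, u) ∈ E → n + #(Tw E u) ≤ #(outN E y) := by
    intro y hy hyT hyu
    have h1 := h.rev.le_of_out hn (isLow_rev.2 hu) (mt inClique_rev.1 huK) (mem_rev.2 hyu)
      (by rw [deg_rev]; exact hnonlow y hy hyT (Or.inr hyu))
    rw [inN_rev, Tw_rev] at h1
    have h2 := card_sdiff_Tw_add hyT hyu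
    omega
  have hkey : ∀ c : ℚ, 0 ≤ c → (∀ y ∈ supp E, y ∉ Tw E u → (u, y) ∈ E ∨ (y, u) ∈ E →
      arcsBetween E u y * c ≤ flow n E y u) →
      (2 * n + 2 - 2 * #(Tw E u) : ℚ) * c ≤ ∑ x ∈ supp E, flow n E x u := by
    intro c hc hle
    calc _ ≤ (∑ y ∈ supp E \ Tw E u, arcsBetween E u y) * c :=
          mul_le_mul_of_nonneg_right (sum_arcsBetween_sdiff_Tw hl hu) hc
      _ = ∑ y ∈ supp E \ Tw E u, arcsBetween E u y * c := sum_mul _ _ _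
      _ ≤ ∑ y ∈ supp E \ Tw E u, flow n E y u := by
          refine sum_le_sum fun y hy => ?_
          rw [mem_sdiff] at hy
          by_cases hadj : (u, y) ∈ E ∨ (y, u) ∈ E
          · exact hle y hy.1 hy.2 hadj
          · push Not at hadj
            rw [arcsBetween, if_neg hadj.1, if_neg hadj.2, add_zero, zero_mul]
            exact flow_nonneg hn y u
      _ ≤ _ := sum_flow_le hn sdiff_subset u
  have hbig : ∀ (d : ℕ) (y : V), 2 * n + 2 ≤ d → d ≤ deg E y →
      arcsBetween E u y * share n d ≤ flow n E y u := by
    intro d y hd hdy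
    rw [flow_of_le (hd.trans hdy), arcsBetween_comm]
    exact mul_le_mul_of_nonneg_left (share_mono hn (by omega) hdy) (arcsBetween_nonneg _ _ _)
  have hdeg : ∀ y ∈ supp E, y ∉ Tw E u → (u, y) ∈ E ∨ (y, u) ∈ E →
      2 * n + #(Tw E u) ≤ deg E y := by
    intro y hy hyT hadj
    have ho := h.crit.le_outN hl hy
    have hi := h.crit.le_inN hl hy
    rw [deg]
    rcases hadj with huy | hyu
    · have := hO y hy hyT huy; omega
    · have := hI y hy hyT hyu; omega
  rcases hs1.eq_or_lt with h1 | h2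
  -- Without other twins, a neighbour may have degree 2n + 1. It is then joined to `u` by a single
  -- arc, its smaller side is rich, and it sends as much as a vertex of degree 2n + 2 would.
  · have := hkey (share n (2 * n + 2)) (share_nonneg hn le_rfl) fun y hy hyT hadj => by
      by_cases hd : 2 * n + 2 ≤ deg E y
      · exact hbig _ y le_rfl hd
      have hd1 : deg E y = 2 * n + 1 := by have := hdeg y hy hyT hadj; omega
      have hd2 := hd1
      rw [deg] at hd2
      have ho := h.crit.le_outN hl hy
      have hi := h.crit.le_inN hl hy
      have hc := share_nonneg hn (le_refl (2 * n + 2))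
      rw [flow, if_neg hd, if_pos hd1]
      by_cases huy : (u, y) ∈ E
      · have e1 := hO y hy hyT huy
        have hyu : (y, u) ∉ E := fun hyu => by have := hI y hy hyT hyu; omega
        have hyo : #(outN E y) = n := by omega
        rw [if_pos ⟨huy, hu, hyo, h.rich_outN hn hu huy hyu hyo⟩, arcsBetween, if_pos huy,
          if_neg hyu, if_neg fun hh => hyu hh.1]
        linarith
      · have hyu := hadj.resolve_left huy
        have e1 := hI y hy hyT hyu
        have hyi : #(inN E y) = n := by omega
        rw [if_pos (c := (y, u) ∈ E ∧ _) ⟨hyu, hu, hyi, h.rich_inN hn hu hyu huy hyi⟩,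
          arcsBetween, if_neg huy, if_pos hyu, if_neg fun hh => huy hh.1]
        linarith
    rw [← h1] at this
    have h3 := le_share_single hn
    push_cast at this
    linarith
  · exact (le_share_cluster hn h2 hsn).trans (hkey _ (share_nonneg hn (by omega))
      fun y hy hyT hadj => hbig _ y (by omega) (hdeg y hy hyT hadj))

/-- Summed over all vertices, sent and received charge cancel. So the initial charges, whose sum is
minus the potential, add up to at least 0, while the potential exceeds n² - n - 2 > 0. -/
theorem not_minCounterexample (hn : 4 ≤ n) : ¬ MinCounterexample n E := by
  intro h
  have hnq : (4 : ℚ) ≤ n := by exact_mod_cast hn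
  have hbal : ∀ u ∈ supp E, ∑ x ∈ supp E, flow n E u x ≤
      n * deg E u - (2 * n ^ 2 + n - 2) + ∑ x ∈ supp E, flow n E x u := by
    intro u hus
    have ho := h.crit.le_outN h.loopless hus
    have hi := h.crit.le_inN h.loopless hus
    have hin : 0 ≤ ∑ x ∈ supp E, flow n E x u := sum_nonneg fun x _ => flow_nonneg hn x u
    by_cases h1 : 2 * n + 2 ≤ deg E u
    · rw [sum_flow_of_le h1]; linarith
    by_cases h2 : deg E u = 2 * n + 1
    · have := h.sum_flow_le_of_deg_eq hn hus h2
      rw [h2]; push_cast; linarith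
    have hu : IsLow n E u := by
      rw [deg] at h1 h2
      exact ⟨hus, by omega, by omega⟩
    rw [hu.deg_eq]
    push_cast
    by_cases huK : InClique n E u
    · have := h.sum_flow_le_of_inClique hn hu huK
      linarith
    · have h3 := h.le_sum_flow hn hu huK
      have : ∑ x ∈ supp E, flow n E u x = 0 := sum_eq_zero fun x _ => by
        classical
        rw [hu.flow_eq, if_neg fun hh => huK hh.1]
      linarith
  have hsum := sum_le_sum hbal
  rw [sum_add_distrib, sum_comm (f := fun u x => flow n E x u), sum_sub_distrib, ← mul_sum,
    sum_const, nsmul_eq_mul, ← Nat.cast_sum, sum_deg] at hsum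
  have hlt := h.lt_wt
  rw [wt] at hlt
  have hlt' : (n : ℚ) ^ 2 - n - 2 < (2 * n ^ 2 + n - 2) * #(supp E) - 2 * n * #E := by
    exact_mod_cast hlt
  push_cast at hsum
  nlinarith

/-! ### Existence of a minimal counterexample -/

theorem twinCount_le (E : Finset (V × V)) : twinCount E ≤ #(supp E) * #(supp E) :=
  (card_filter_le _ _).trans (card_product _ _).le

/-- The number of twin pairs is at most the square of the number of vertices. As that number agrees
in a tie, an increase of twins is a decrease of a natural number. -/
theorem wellFounded_smaller : WellFounded (Smaller (V := V)) := by
  refine Subrelation.wf (r := InvImage (Prod.Lex (· < ·) (Prod.Lex (· < ·) (· < ·)))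
    fun E : Finset (V × V) => (#(supp E), #E, #(supp E) * #(supp E) - twinCount E)) ?_
    (InvImage.wf _ (wellFounded_lt.prod_lex (wellFounded_lt.prod_lex wellFounded_lt)))
  intro F E h
  have hF := twinCount_le F
  simp only [InvImage, Prod.lex_def]
  rcases h with h | ⟨h1, h | ⟨h2, h3⟩⟩
  · exact Or.inl h
  · exact Or.inr ⟨h1, Or.inl h⟩
  · rw [h1] at hF ⊢
    exact Or.inr ⟨rfl, Or.inr ⟨h2, by omega⟩⟩

/-- The bound on the number of arcs of a critical digraph. -/
theorem Crit.wt_le (hn : 4 ≤ n) (hl : Loopless E) (h : Crit n E) :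
    wt n #(supp E) #E ≤ (n : ℤ) ^ 2 - n - 2 := by
  refine wellFounded_smaller.induction
    (C := fun E => Loopless E → Crit n E → wt n #(supp E) #E ≤ (n : ℤ) ^ 2 - n - 2) E
    (fun E ih hl h => ?_) hl h
  by_contra! hlt
  exact not_minCounterexample hn ⟨hl, h, hlt, fun F hFl hF hs => ih F hs hFl hF⟩

end ArcSet

/-! ### Back to dicritical digraphs -/

namespace FinDigraph

open ArcSet Finset

variable {V : Type*} {G : FinDigraph V} {n : ℕ}

/-- `Col` colours all of `V`, so vertices outside `G` need a default colour; hence 0 < n. -/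
theorem isDicolourable_iff (hn : 0 < n) : G.IsDicolourable n ↔ Col n G.arcs := by
  classical
  constructor
  · rintro ⟨φ, hφ, hφ'⟩
    refine ⟨fun v => if h : φ v < n then ⟨φ v, h⟩ else ⟨0, hn⟩, fun v hv => ?_⟩
    have hv' : Relation.TransGen (fun x y => (x, y) ∈ G.arcs ∧ φ x = φ y) v v := by
      refine Relation.TransGen.mono (fun x y hxy => ⟨hxy.1, ?_⟩) _ _ hv
      have h := hxy.2
      dsimp only at h
      rw [dif_pos (hφ _ (G.fst_mem _ hxy.1)), dif_pos (hφ _ (G.snd_mem _ hxy.1)),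
        Fin.mk.injEq] at h
      exact h
    refine hφ' (φ v) v (Relation.TransGen.mono (fun x y hxy => ?_) _ _ (transGen_fiber φ hv').2)
    exact mem_arcs_induce.2 ⟨hxy.1, hxy.2.1, hxy.2.2⟩
  · rintro ⟨χ, hχ⟩
    refine ⟨fun v => χ v, fun v _ => (χ v).isLt, fun i v hv => hχ v ?_⟩
    refine Relation.TransGen.mono (fun x y hxy => ?_) _ _ hv
    obtain ⟨h, h1, h2⟩ := mem_arcs_induce.1 hxy
    exact ⟨h, Fin.ext (Eq.trans h1 (Eq.symm h2))⟩

theorem IsDicolourable.mono {m : ℕ} (h : G.IsDicolourable m) (hmn : m ≤ n) : G.IsDicolourable n :=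
  h.imp fun _ hφ => ⟨fun v hv => (hφ.1 v hv).trans_le hmn, hφ.2⟩

theorem dichromaticNumber_le_iff : G.dichromaticNumber ≤ n ↔ G.IsDicolourable n :=
  ⟨fun h => IsDicolourable.mono (Nat.sInf_mem G.exists_isDicolourable) h, fun h => Nat.sInf_le h⟩

theorem dichromaticNumber_le_iff_col (hn : 0 < n) : G.dichromaticNumber ≤ n ↔ Col n G.arcs :=
  dichromaticNumber_le_iff.trans (isDicolourable_iff hn)

/-- A dicritical digraph with dichromatic number at least two has no isolated vertices, and its arc
set is critical. -/
theorem IsKDicritical.crit [DecidableEq V] (hn : 0 < n) (hG : G.IsKDicritical (n + 1)) :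
    Crit n G.arcs ∧ G.verts = supp G.arcs := by
  obtain ⟨hG, hk⟩ := hG
  have hnot : ¬ Col n G.arcs := by
    rw [← dichromaticNumber_le_iff_col hn, hk]; omega
  have hsub : supp G.arcs ⊆ G.verts :=
    supp_subset_iff.2 fun a ha => ⟨G.fst_mem a ha, G.snd_mem a ha⟩
  refine ⟨⟨hnot, fun F hF => ?_⟩, ?_⟩
  · let H : FinDigraph V := ⟨G.verts, F, fun a ha => G.fst_mem a (hF.1 ha),
      fun a ha => G.snd_mem a (hF.1 ha), fun a ha => G.fst_ne_snd a (hF.1 ha)⟩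
    have hlt := hG H ⟨Subset.refl _, hF.1⟩ fun hh => hF.ne (congrArg arcs hh)
    rw [hk, Nat.lt_succ_iff] at hlt
    exact (dichromaticNumber_le_iff_col hn).1 hlt
  · by_contra hne
    -- Dropping isolated vertices keeps all arcs, so the dichromatic number cannot fall to `n` or
    -- below.
    let H : FinDigraph V := ⟨supp G.arcs, G.arcs, fun a ha => fst_mem_supp ha,
      fun a ha => snd_mem_supp ha, G.fst_ne_snd⟩
    have hlt := hG H ⟨hsub, Subset.refl _⟩ fun hh => hne (congrArg verts hh).symm
    rw [hk, Nat.lt_succ_iff] at hlt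
    exact hnot ((dichromaticNumber_le_iff_col (G := H) hn).1 hlt)

end FinDigraph

/-- A lower bound on the number of arcs of a dicritical digraph. -/
theorem mainTheorem4 {V : Type*} (k : ℕ) (hk : 5 ≤ k) (G : FinDigraph V)
    (hG : G.IsKDicritical k) :
    (G.arcs.card : ℝ) ≥
      ((k : ℝ) - 1 / 2 - 1 / ((k : ℝ) - 1)) * (G.verts.card : ℝ)
        - (k : ℝ) * (1 / 2 - 1 / ((k : ℝ) - 1)) := by
  classical
  obtain ⟨n, rfl⟩ : ∃ n, k = n + 1 := ⟨k - 1, by omega⟩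
  have hn : 4 ≤ n := by omega
  obtain ⟨hcrit, hverts⟩ := hG.crit (by omega)
  have hwt := hcrit.wt_le hn fun a ha => G.fst_ne_snd a ha
  rw [ArcSet.wt, ← hverts] at hwt
  have hwt' : (2 * n ^ 2 + n - 2 : ℝ) * G.verts.card - 2 * n * G.arcs.card ≤ n ^ 2 - n - 2 := by
    exact_mod_cast hwt
  have hn0 : (0 : ℝ) < n := by positivity
  have hrhs : ((n + 1 : ℕ) - 1 / 2 - 1 / (((n + 1 : ℕ) : ℝ) - 1)) * (G.verts.card : ℝ)
      - ((n + 1 : ℕ) : ℝ) * (1 / 2 - 1 / (((n + 1 : ℕ) : ℝ) - 1)) =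
      ((2 * n ^ 2 + n - 2) * G.verts.card - (n ^ 2 - n - 2)) / (2 * n) := by
    push_cast
    rw [add_sub_cancel_right]
    field_simp
    ring
  rw [hrhs, ge_iff_le, div_le_iff₀ (by positivity)]
  linarith
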